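/- Let $m,n,r\ge 0$ be integers and let $Y\in\mathbb R^{m\times n}$ satisfy $r\le\operatorname{rank}(Y)$ and have mutually distinct nonzero singular values (each nonzero singular value has multiplicity one). For $(A,B)\in\mathbb R^{m\times r}\times\mathbb R^{r\times n}$ put $$\mathcal L(A,B)=\tfrac12\|AB-Y\|_F^2,\qquad \nabla_A\mathcal L=(AB-Y)B^\top,\qquad \nabla_B\mathcal L=A^\top(AB-Y),\qquad \|\nabla\mathcal L\|=\big(\|\nabla_A\mathcal L\|_F^2+\|\nabla_B\mathcal L\|_F^2\big)^{1/2}.$$ For $\beta>0$ let $\mathcal T_\beta(M)=(MM^\top+\beta I)^{-1/2}M$. A solution of the spectral gradient flow (SpecGF) with $\mathcal T_\beta$ is a differentiable curve $t\mapsto(A(t),B(t))$ on $[0,\infty)$ with $$\dot A(t)=-\mathcal T_\beta\big(\nabla_A\mathcal L(A(t),B(t))\big),\qquad \dot B(t)=-\mathcal T_\beta\big(\nabla_B\mathcal L(A(t),B(t))\big)\qquad(t\ge 0).$$ Let $(\bar A,\bar B)$ be any global minimizer of $\mathcal L$, and let $S=\{(\bar AQ,\,Q^{-1}\bar B):Q\in\mathsf{GL}(r)\}$.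 Then: 1. (Morse–Bott) $\bar A$ and $\bar B$ have rank $r$; $S$ is the set of all global minimizers of $\mathcal L$; every critical point of $\mathcal L$ sufficiently close to $(\bar A,\bar B)$ lies in $S$; and the kernel of the Hessian of $\mathcal L$ at $(\bar A,\bar B)$ equals the tangent space of $S$ at $(\bar A,\bar B)$, i.e. the set of velocities $\gamma'(0)$ of curves $\gamma$ in $S$ with $\gamma(0)=(\bar A,\bar B)$ that are differentiable at $0$. 2. There is a constant $C>0$, depending only on $Y$ and $(\bar A,\bar B)$, such that (a) (Łojasiewicz inequality with exponent $\tfrac12$) $\big(\mathcal L(A,B)-\mathcal L(\bar A,\bar B)\big)^{1/2}\le C\,\|\nabla\mathcal L(A,B)\|$ for all $(A,B)$ in a neighbourhood of $(\bar A,\bar B)$; (b) (exponential convergence) for every $\beta>0$ and every solution $(A(t),B(t))$ of SpecGF with $\mathcal T_\beta$ that converges to $(\bar A,\bar B)$ as $t\to\infty$, there is $T\ge 0$ such that for all $t\ge T$ $$\mathcal L(A(t),B(t))-\mathcal L(\bar A,\bar B)\;\le\;\big(\mathcal L(A(T),B(T))-\mathcal L(\bar A,\bar B)\big)\,\exp\!\Big(-\frac{t-T}{C^2\sqrt{2\beta}}\Big).$$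 -/

import Mathlib

open Filter Topology
open scoped Matrix Matrix.Norms.Frobenius

namespace SpecGF

/-- Pairs of factors `(A, B)` with `A` of size `m × r` and `B` of size `r × n`. -/
abbrev Factors (m n r : ℕ) : Type :=
  Matrix (Fin m) (Fin r) ℝ × Matrix (Fin r) (Fin n) ℝ

/-- The factorization loss `L(A, B) = ½ ‖A B - Y‖²` (Frobenius norm). -/
noncomputable def loss {m n r : ℕ} (Y : Matrix (Fin m) (Fin n) ℝ) (x : Factors m n r) : ℝ :=
  1 / 2 * ‖x.1 * x.2 - Y‖ ^ 2

/-- The partial gradient of the loss with respect to `A`, namely `(A B - Y) Bᵀ`. -/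
def gradA {m n r : ℕ} (Y : Matrix (Fin m) (Fin n) ℝ) (x : Factors m n r) :
    Matrix (Fin m) (Fin r) ℝ :=
  (x.1 * x.2 - Y) * x.2ᵀ

/-- The partial gradient of the loss with respect to `B`, namely `Aᵀ (A B - Y)`. -/
def gradB {m n r : ℕ} (Y : Matrix (Fin m) (Fin n) ℝ) (x : Factors m n r) :
    Matrix (Fin r) (Fin n) ℝ :=
  x.1ᵀ * (x.1 * x.2 - Y)

/-- The squared Frobenius norm as a trace. -/
theorem norm_sq_eq_trace {p q : ℕ} (M : Matrix (Fin p) (Fin q) ℝ) :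
    ‖M‖ ^ 2 = (M * Mᵀ).trace := by
  rw [Matrix.frobenius_norm_def, ← Real.sqrt_eq_rpow, Real.sq_sqrt (by positivity)]
  simp only [Matrix.trace, Matrix.diag, Matrix.mul_apply, Matrix.transpose_apply]
  refine Finset.sum_congr rfl fun i _ => Finset.sum_congr rfl fun j _ => ?_
  rw [Real.norm_eq_abs, Real.rpow_two, sq_abs, sq]

/-- `(gradA, gradB)` is the gradient of the loss for the inner product `⟨M, N⟩ = tr (M Nᵀ)`. -/
theorem hasDerivAt_loss {m n r : ℕ} (Y : Matrix (Fin m) (Fin n) ℝ) (x v : Factors m n r) :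
    HasDerivAt (fun s : ℝ => loss Y (x + s • v))
      ((gradA Y x * v.1ᵀ).trace + (gradB Y x * v.2ᵀ).trace) 0 := by
  obtain ⟨A, B⟩ := x
  obtain ⟨P, Q⟩ := v
  have key : (fun s : ℝ => loss Y ((A, B) + s • (P, Q))) = fun s : ℝ =>
      1 / 2 * (((A * B - Y) * (A * B - Y)ᵀ).trace
        + s * (2 * ((A * B - Y) * (A * Q + P * B)ᵀ).trace)
        + s ^ 2 * (((A * Q + P * B) * (A * Q + P * B)ᵀ).trace
            + 2 * ((A * B - Y) * (P * Q)ᵀ).trace)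
        + s ^ 3 * (2 * ((A * Q + P * B) * (P * Q)ᵀ).trace)
        + s ^ 4 * ((P * Q) * (P * Q)ᵀ).trace) := by
    funext s
    have e : (A + s • P) * (B + s • Q) - Y
        = (A * B - Y) + s • (A * Q + P * B) + s ^ 2 • (P * Q) := by
      simp only [Matrix.add_mul, Matrix.mul_add, Matrix.smul_mul, Matrix.mul_smul, smul_add,
        smul_smul, sq]
      abel
    have sym : ∀ M N : Matrix (Fin m) (Fin n) ℝ, (N * Mᵀ).trace = (M * Nᵀ).trace := by
      intro M N
      rw [← Matrix.trace_transpose, Matrix.transpose_mul, Matrix.transpose_transpose]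
    simp only [loss, Prod.fst_add, Prod.snd_add, Prod.smul_fst, Prod.smul_snd, e,
      norm_sq_eq_trace]
    generalize A * B - Y = R
    generalize A * Q + P * B = D
    generalize P * Q = F
    simp only [Matrix.transpose_add, Matrix.transpose_smul, Matrix.add_mul, Matrix.mul_add,
      Matrix.smul_mul, Matrix.mul_smul, Matrix.trace_add, Matrix.trace_smul, smul_eq_mul,
      sym R D, sym R F, sym D F]
    ring
  have val : ((gradA Y (A, B) * Pᵀ).trace + (gradB Y (A, B) * Qᵀ).trace)
      = ((A * B - Y) * (A * Q + P * B)ᵀ).trace := by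
    simp only [gradA, gradB, Matrix.transpose_add, Matrix.transpose_mul, Matrix.mul_add,
      Matrix.trace_add]
    rw [Matrix.mul_assoc Aᵀ, Matrix.trace_mul_comm Aᵀ, Matrix.mul_assoc, Matrix.mul_assoc]
    ring
  rw [key]
  simp only [val]
  generalize ((A * B - Y) * (A * Q + P * B)ᵀ).trace = b
  have h := (((((hasDerivAt_const (0 : ℝ) ((A * B - Y) * (A * B - Y)ᵀ).trace).add
    ((hasDerivAt_id (0 : ℝ)).mul_const (2 * b))).add
    ((hasDerivAt_pow 2 (0 : ℝ)).mul_const (((A * Q + P * B) * (A * Q + P * B)ᵀ).trace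
            + 2 * ((A * B - Y) * (P * Q)ᵀ).trace))).add
    ((hasDerivAt_pow 3 (0 : ℝ)).mul_const (2 * ((A * Q + P * B) * (P * Q)ᵀ).trace))).add
    ((hasDerivAt_pow 4 (0 : ℝ)).mul_const ((P * Q) * (P * Q)ᵀ).trace)).const_mul (1 / 2 : ℝ)
  exact h.congr_deriv (by ring)

/-- The Frobenius norm `‖∇L‖ = (‖∇_A L‖² + ‖∇_B L‖²)^{1/2}` of the full gradient. -/
noncomputable def gradNorm {m n r : ℕ} (Y : Matrix (Fin m) (Fin n) ℝ) (x : Factors m n r) : ℝ :=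
  √(‖gradA Y x‖ ^ 2 + ‖gradB Y x‖ ^ 2)

/-- The smoothed orthogonalization `T_β(M) = (M Mᵀ + β I)^{-1/2} M`; the power `-1/2` of the
symmetric positive definite matrix is taken in the continuous functional calculus. -/
noncomputable def Tβ {p q : ℕ} (β : ℝ) (M : Matrix (Fin p) (Fin q) ℝ) :
    Matrix (Fin p) (Fin q) ℝ :=
  cfc (fun s : ℝ => s ^ (-(1 / 2) : ℝ)) (M * Mᵀ + β • (1 : Matrix (Fin p) (Fin p) ℝ)) * M

/-- `x : t ↦ (A(t), B(t))` solves `A' = -T_β(∇_A L)`, `B' = -T_β(∇_B L)` on `[0, ∞)`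
(with the one-sided derivative at `0`). -/
def IsSpecGF {m n r : ℕ} (Y : Matrix (Fin m) (Fin n) ℝ) (β : ℝ) (x : ℝ → Factors m n r) : Prop :=
  ∀ t : ℝ, 0 ≤ t →
    HasDerivWithinAt x (-Tβ β (gradA Y (x t)), -Tβ β (gradB Y (x t))) (Set.Ici 0) t

/-- The set of global minimizers of the loss. -/
def minimizers {m n : ℕ} (r : ℕ) (Y : Matrix (Fin m) (Fin n) ℝ) : Set (Factors m n r) :=
  {x | ∀ y : Factors m n r, loss Y x ≤ loss Y y}

/-- The orbit `{(A Q, Q⁻¹ B) : Q ∈ GL(r)}` of `(A, B)`. -/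
def orbit {m n r : ℕ} (x : Factors m n r) : Set (Factors m n r) :=
  Set.range fun Q : GL (Fin r) ℝ =>
    (x.1 * (Q : Matrix (Fin r) (Fin r) ℝ), ((Q⁻¹ : GL (Fin r) ℝ) : Matrix (Fin r) (Fin r) ℝ) * x.2)

/-- The tangent vectors of `S` at `x`: velocities at time `0` of curves in `S` through `x`. -/
def tangentVectors {m n r : ℕ} (S : Set (Factors m n r)) (x : Factors m n r) :
    Set (Factors m n r) :=
  {v | ∃ γ : ℝ → Factors m n r, γ 0 = x ∧ (∀ᶠ s in 𝓝 (0 : ℝ), γ s ∈ S) ∧ HasDerivAt γ v 0}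

/-- The Hessian bilinear form of the loss (a polynomial) at `x`, as the mixed second directional
derivative along `u` and `v`. -/
noncomputable def hessian {m n r : ℕ} (Y : Matrix (Fin m) (Fin n) ℝ) (x u v : Factors m n r) : ℝ :=
  deriv (fun s : ℝ => deriv (fun t : ℝ => loss Y (x + s • u + t • v)) 0) 0

/-- The kernel of the Hessian of the loss at `x`. -/
def hessianKer {m n r : ℕ} (Y : Matrix (Fin m) (Fin n) ℝ) (x : Factors m n r) :
    Set (Factors m n r) :=
  {u | ∀ v : Factors m n r, hessian Y x u v = 0}

/-- The nonzero singular values of `Y`, listed with multiplicity, are mutually distinct. -/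
def DistinctSingularValues {m n : ℕ} (Y : Matrix (Fin m) (Fin n) ℝ) : Prop :=
  ∀ i j : ℕ, (Matrix.toEuclideanLin Y).singularValues i ≠ 0 →
    (Matrix.toEuclideanLin Y).singularValues i = (Matrix.toEuclideanLin Y).singularValues j → i = j

end SpecGF

/-!
# Morse–Bott property and exponential convergence for spectral gradient flow

The hypotheses give a number `μ > 0` lying strictly between the `r`-th and the `(r+1)`-st largest
eigenvalue of `Yᵀ Y` (`exists_spectralGap`). Everything else rests on this gap.

*Minimizers.* If `P` projects onto the row space of `B`, then `‖A B - Y‖² ≥ ‖Y‖² - tr (Yᵀ Y P)`.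
The equality case of Ky Fan's principle (`SpectralGap.projection_eq`) forces `P` to be the spectral
projection at every minimizer, so that `A B` is the unique best rank-`r` approximation of `Y`
(`SpectralGap.eq_of_mem_minimizers`). Both factors then have rank `r`, and full-rank factorizations
of one matrix form a `GL(r)`-orbit (`mem_orbit_of_mul_eq`).

*Hessian.* For `(P, Q)` in the kernel of the Hessian, `M = P B + A Q` and `R = A B - Y`, the
linearized critical point equations give the Sylvester equation `M (A B)ᵀ (A B) = R Rᵀ M`. The
nonzero spectrum of `(A B)ᵀ (A B)` lies above `μ`, that of `R Rᵀ` below, which forces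
`(P, Q) = (A X, -X B)` for some `X` (`SpectralGap.exists_generator`). These are the velocities of
`(A exp(sX), exp(-sX) B)`; conversely the gradient vanishes along the orbit, so tangent vectors lie
in the kernel.

*Łojasiewicz inequality.* With a left inverse `L` of `A`, the affine slice `{(A', B') | L A' = 1}`
meets the kernel directions trivially, so on it the gradient is bounded below by a multiple of the
distance to the minimizer, while the excess loss is at most quadratic. A point near the minimizer is
moved into the slice by `g = L A' ∈ GL(r)`, which is close to `1` (`sliceRep`). The same estimate
shows that nearby critical points are in the orbit.

*Flow.* As soon as `‖∇L‖² ≤ β`, the matrix `M Mᵀ + β I` has its spectrum in `[β, 2β]` for each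
partial gradient `M`, whence `dL/dt ≤ -(2β)^{-1/2} ‖∇L‖²` (`norm_sq_le_trace_Tβ`), and the
Łojasiewicz inequality with a Grönwall argument gives the exponential rate.
-/

namespace SpecGF

open Matrix

/-! ### Spectral gap of `Yᵀ Y` -/

theorem transpose_mul_self_apply_self {p q : ℕ} (M : Matrix (Fin p) (Fin q) ℝ) (i : Fin q) :
    (Mᵀ * M) i i = ∑ k, M k i ^ 2 := by
  simp [Matrix.mul_apply, sq]

theorem transpose_mul_self_apply_self_nonneg {p q : ℕ} (M : Matrix (Fin p) (Fin q) ℝ)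
    (i : Fin q) : 0 ≤ (Mᵀ * M) i i := by
  rw [transpose_mul_self_apply_self]
  positivity

theorem col_eq_zero_of_transpose_mul_self {p q : ℕ} {M : Matrix (Fin p) (Fin q) ℝ} {i : Fin q}
    (h : (Mᵀ * M) i i = 0) (k : Fin p) : M k i = 0 := by
  rw [transpose_mul_self_apply_self,
    Finset.sum_eq_zero_iff_of_nonneg (fun k _ => sq_nonneg (M k i))] at h
  exact pow_eq_zero_iff two_ne_zero |>.1 (h k (Finset.mem_univ k))

theorem norm_sq_eq_trace_transpose_mul {p q : ℕ} (M : Matrix (Fin p) (Fin q) ℝ) :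
    ‖M‖ ^ 2 = (Mᵀ * M).trace := by
  rw [norm_sq_eq_trace, Matrix.trace_mul_comm]

/-- The columns of `V₁` and `V₂` together form an orthonormal basis of eigenvectors of `Yᵀ Y`, with
eigenvalues `d₁` and `d₂`, and the number `μ > 0` separates `d₁` (above) from `d₂` (below). -/
structure SpectralGap {m n r s : ℕ} (Y : Matrix (Fin m) (Fin n) ℝ)
    (V₁ : Matrix (Fin n) (Fin r) ℝ) (V₂ : Matrix (Fin n) (Fin s) ℝ)
    (d₁ : Fin r → ℝ) (d₂ : Fin s → ℝ) (μ : ℝ) : Prop where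
  orth₁ : V₁ᵀ * V₁ = 1
  orth₂ : V₂ᵀ * V₂ = 1
  orth₁₂ : V₁ᵀ * V₂ = 0
  complete : V₁ * V₁ᵀ + V₂ * V₂ᵀ = 1
  eigen₁ : Yᵀ * Y * V₁ = V₁ * diagonal d₁
  eigen₂ : Yᵀ * Y * V₂ = V₂ * diagonal d₂
  pos : 0 < μ
  above : ∀ i, μ < d₁ i
  below : ∀ j, d₂ j < μ

/-- The columns of `V` are eigenvectors of `Yᵀ Y`, in decreasing order of the eigenvalues. -/
theorem exists_orthogonal_diagonalization {m n : ℕ} (Y : Matrix (Fin m) (Fin n) ℝ) :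
    ∃ V : Matrix (Fin n) (Fin n) ℝ, Vᵀ * V = 1 ∧
      Yᵀ * Y * V =
        V * diagonal (fun i : Fin n => (Matrix.toEuclideanLin Y).singularValues i ^ 2) := by
  classical
  set T := Matrix.toEuclideanLin Y with hT
  have hn : Module.finrank ℝ (EuclideanSpace ℝ (Fin n)) = n := by simp
  set b := T.isSymmetric_adjoint_comp_self.eigenvectorBasis hn with hb
  refine ⟨Matrix.of fun i j => b j i, ?_, ?_⟩
  · ext i j
    have := orthonormal_iff_ite.1 b.orthonormal i j
    simp only [PiLp.inner_apply, RCLike.inner_apply, conj_trivial] at this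
    simp only [Matrix.mul_apply, Matrix.transpose_apply, Matrix.of_apply, Matrix.one_apply]
    rw [← this]
    exact Finset.sum_congr rfl fun k _ => mul_comm _ _
  · ext i j
    have h1 := T.isSymmetric_adjoint_comp_self.apply_eigenvectorBasis hn j
    rw [← T.sq_singularValues_fin hn j] at h1
    have hadj : LinearMap.adjoint T = Matrix.toEuclideanLin Yᵀ := by
      rw [hT, ← Matrix.toEuclideanLin_conjTranspose_eq_adjoint]
      simp
    rw [← hb, LinearMap.comp_apply, hadj] at h1
    have h2 := congrArg (fun v : EuclideanSpace ℝ (Fin n) => v i) h1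
    rw [Matrix.mul_diagonal, Matrix.mul_assoc]
    simp only [hT, Matrix.toLpLin_apply, PiLp.smul_apply,
      smul_eq_mul] at h2
    simp only [RCLike.ofReal_real_eq_id, id_eq] at h2
    rw [Matrix.of_apply, mul_comm, ← h2]
    simp only [Matrix.mul_apply, Matrix.mulVec, dotProduct, Matrix.of_apply]

/-- The gap: `σᵣ > σᵣ₊₁` (in the one-based order), because `σᵣ ≠ 0` as `r ≤ rank Y` and nonzero
singular values are simple. -/
theorem exists_spectralGap {m n r : ℕ} (Y : Matrix (Fin m) (Fin n) ℝ) (hr : r ≤ Y.rank)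
    (hY : DistinctSingularValues Y) :
    ∃ (s : ℕ) (V₁ : Matrix (Fin n) (Fin r) ℝ) (V₂ : Matrix (Fin n) (Fin s) ℝ)
      (d₁ : Fin r → ℝ) (d₂ : Fin s → ℝ) (μ : ℝ), SpectralGap Y V₁ V₂ d₁ d₂ μ := by
  classical
  obtain ⟨s, rfl⟩ := Nat.exists_eq_add_of_le (hr.trans (by simpa using Y.rank_le_width))
  obtain ⟨V, hV, hYV⟩ := exists_orthogonal_diagonalization Y
  set σ := (Matrix.toEuclideanLin Y).singularValues with hσ
  have hpos : ∀ i : Fin r, 0 < σ i := fun i => by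
    rw [hσ, LinearMap.singularValues_pos_iff_lt_finrank_range]
    rw [Matrix.rank_eq_finrank_range_toLin Y (EuclideanSpace.basisFun _ ℝ).toBasis
      (EuclideanSpace.basisFun _ ℝ).toBasis] at hr
    have : Matrix.toLin (EuclideanSpace.basisFun (Fin (r+s)) ℝ).toBasis
      (EuclideanSpace.basisFun (Fin m) ℝ).toBasis Y = Matrix.toEuclideanLin Y := by
      rw [Matrix.toEuclideanLin_eq_toLin_orthonormal]
    rw [this] at hr
    exact i.2.trans_le hr
  have hlt : ∀ (i : Fin r) (j : Fin s), σ (r + j) < σ i := fun i j => by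
    refine lt_of_le_of_ne (LinearMap.singularValues_antitone _ (by omega)) fun h => ?_
    have := hY i (r + j) (hpos i).ne' h.symm
    omega
  obtain ⟨μ, hμ₁, hμ₂⟩ := Order.exists_between_finsets
    (insert 0 (Finset.univ.image fun j : Fin s => σ (r + j) ^ 2))
    (Finset.univ.image fun i : Fin r => σ i ^ 2) (by
      intro x hx y hy
      obtain ⟨i, -, rfl⟩ := Finset.mem_image.1 hy
      rcases Finset.mem_insert.1 hx with rfl | hx
      · exact pow_pos (hpos i) 2
      · obtain ⟨j, -, rfl⟩ := Finset.mem_image.1 hx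
        exact pow_lt_pow_left₀ (hlt i j) (LinearMap.singularValues_nonneg _ _) two_ne_zero)
  have hV' : V * Vᵀ = 1 := mul_eq_one_comm.1 hV
  refine ⟨s, V.submatrix id (Fin.castAdd s), V.submatrix id (Fin.natAdd r),
    fun i => σ i ^ 2, fun j => σ (r + j) ^ 2, μ, ?_, ?_, ?_, ?_, ?_, ?_, ?_, ?_, ?_⟩
  · ext i j
    have := congrFun (congrFun hV (Fin.castAdd s i)) (Fin.castAdd s j)
    simpa [Matrix.mul_apply, Matrix.one_apply] using this
  · ext i j
    have := congrFun (congrFun hV (Fin.natAdd r i)) (Fin.natAdd r j)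
    simpa [Matrix.mul_apply, Matrix.one_apply] using this
  · ext i j
    have := congrFun (congrFun hV (Fin.castAdd s i)) (Fin.natAdd r j)
    have h' : Fin.castAdd s i ≠ Fin.natAdd r j := by
      intro h
      have := congrArg Fin.val h
      simp at this
      omega
    simpa [Matrix.mul_apply, Matrix.one_apply, h'] using this
  · rw [← hV']
    ext i j
    simp [Matrix.mul_apply, Fin.sum_univ_add]
  · ext i j
    have := congrFun (congrFun hYV i) (Fin.castAdd s j)
    simpa [Matrix.mul_apply, Matrix.diagonal_apply] using this
  · ext i j
    have := congrFun (congrFun hYV i) (Fin.natAdd r j)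
    simpa [Matrix.mul_apply, Matrix.diagonal_apply] using this
  · exact hμ₁ 0 (Finset.mem_insert_self _ _)
  · exact fun i => hμ₂ _ (Finset.mem_image_of_mem _ (Finset.mem_univ i))
  · exact fun j => hμ₁ _ (Finset.mem_insert_of_mem (Finset.mem_image_of_mem
      (fun j : Fin s => σ (r + j) ^ 2) (Finset.mem_univ j)))

/-! ### Eckart–Young theorem with uniqueness -/

/-- `P` is the orthogonal projection onto the row space of `B`; its trace is the rank of `B`. -/
theorem exists_rowSpace_projection {r n : ℕ} (B : Matrix (Fin r) (Fin n) ℝ) :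
    ∃ P : Matrix (Fin n) (Fin n) ℝ, Pᵀ = P ∧ P * P = P ∧ B * P = B ∧ P.trace ≤ r := by
  classical
  have hH : (Bᵀ * B).IsHermitian := by
    have := Matrix.isHermitian_conjTranspose_mul_self B
    rwa [Matrix.conjTranspose_eq_transpose_of_trivial] at this
  set U : Matrix (Fin n) (Fin n) ℝ := hH.eigenvectorUnitary.1 with hU
  have hU1 : Uᵀ * U = 1 := by
    have := Unitary.coe_star_mul_self hH.eigenvectorUnitary
    rwa [Matrix.star_eq_conjTranspose, Matrix.conjTranspose_eq_transpose_of_trivial] at this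
  have hU2 : U * Uᵀ = 1 := mul_eq_one_comm.1 hU1
  set d := hH.eigenvalues with hd
  have hsp : Bᵀ * B = U * diagonal d * Uᵀ := by
    have := hH.spectral_theorem
    rw [Unitary.conjStarAlgAut_apply, Matrix.star_eq_conjTranspose,
      Matrix.conjTranspose_eq_transpose_of_trivial] at this
    simpa [Function.comp_def] using this
  set e : Fin n → ℝ := fun i => if d i = 0 then 0 else 1 with he
  have hee : diagonal e * diagonal e = diagonal e := by
    rw [Matrix.diagonal_mul_diagonal]
    congr 1; ext i; simp [he]
  refine ⟨U * diagonal e * Uᵀ, ?_, ?_, ?_, ?_⟩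
  · simp [Matrix.transpose_mul, Matrix.mul_assoc]
  · calc U * diagonal e * Uᵀ * (U * diagonal e * Uᵀ)
        = U * diagonal e * (Uᵀ * U) * diagonal e * Uᵀ := by simp only [Matrix.mul_assoc]
      _ = U * diagonal e * Uᵀ := by rw [hU1, Matrix.mul_one, Matrix.mul_assoc U, hee]
  · have h0 : (B * U)ᵀ * (B * U) = diagonal d := by
      calc (B * U)ᵀ * (B * U) = Uᵀ * (Bᵀ * B) * U := by
            simp only [Matrix.transpose_mul, Matrix.mul_assoc]
        _ = (Uᵀ * U) * diagonal d * (Uᵀ * U) := by rw [hsp]; simp only [Matrix.mul_assoc]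
        _ = diagonal d := by rw [hU1, Matrix.one_mul, Matrix.mul_one]
    have h1 : B * U * diagonal e = B * U := by
      ext k i
      rw [Matrix.mul_diagonal]
      by_cases hi : d i = 0
      · rw [col_eq_zero_of_transpose_mul_self (M := B * U) (i := i) (by rw [h0]; simp [hi]) k,
          zero_mul]
      · simp [he, hi]
    rw [← Matrix.mul_assoc, ← Matrix.mul_assoc, h1, Matrix.mul_assoc, hU2, Matrix.mul_one]
  · rw [Matrix.mul_assoc, Matrix.trace_mul_comm, Matrix.mul_assoc, hU1, Matrix.mul_one,
      Matrix.trace_diagonal]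
    have h2 : (Bᵀ * B).rank ≤ r :=
      (Matrix.rank_mul_le_right _ _).trans (by simpa using B.rank_le_height)
    rw [hH.rank_eq_card_non_zero_eigs, Fintype.card_subtype] at h2
    have h3 : ∑ i, e i = ((Finset.univ.filter fun i => d i ≠ 0).card : ℝ) := by
      rw [Finset.card_filter]
      push_cast
      refine Finset.sum_congr rfl fun i _ => ?_
      by_cases hi : d i = 0 <;> simp [he, hi]
    rw [h3]
    exact_mod_cast h2

section
variable {m n r s : ℕ} {Y : Matrix (Fin m) (Fin n) ℝ} {V₁ : Matrix (Fin n) (Fin r) ℝ}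
  {V₂ : Matrix (Fin n) (Fin s) ℝ} {d₁ : Fin r → ℝ} {d₂ : Fin s → ℝ} {μ : ℝ}

theorem SpectralGap.orth₂₁ (h : SpectralGap Y V₁ V₂ d₁ d₂ μ) : V₂ᵀ * V₁ = 0 := by
  rw [← Matrix.transpose_transpose (V₂ᵀ * V₁), Matrix.transpose_mul, Matrix.transpose_transpose,
    h.orth₁₂, Matrix.transpose_zero]

theorem SpectralGap.trace_mul (h : SpectralGap Y V₁ V₂ d₁ d₂ μ) (K : Matrix (Fin n) (Fin n) ℝ) :
    K.trace = (V₁ᵀ * K * V₁).trace + (V₂ᵀ * K * V₂).trace := by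
  conv_lhs => rw [← Matrix.mul_one K, ← h.complete, Matrix.mul_add, Matrix.trace_add]
  rw [← Matrix.mul_assoc, ← Matrix.mul_assoc, Matrix.trace_mul_comm, Matrix.trace_mul_comm _ V₂ᵀ,
    ← Matrix.mul_assoc, ← Matrix.mul_assoc]

/-- Ky Fan's maximum principle with its equality case: among the orthogonal projections `P` of
trace at most `r`, only the spectral projection `V₁ V₁ᵀ` attains `tr (Yᵀ Y P) ≥ ∑ d₁`. -/
theorem SpectralGap.projection_eq (h : SpectralGap Y V₁ V₂ d₁ d₂ μ)
    {P : Matrix (Fin n) (Fin n) ℝ} (hPt : Pᵀ = P) (hPP : P * P = P) (hPr : P.trace ≤ r)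
    (hP : ∑ i, d₁ i ≤ (Yᵀ * Y * P).trace) : P = V₁ * V₁ᵀ := by
  have e1 : V₁ᵀ * P * V₁ = (P * V₁)ᵀ * (P * V₁) := by
    rw [Matrix.transpose_mul, hPt, Matrix.mul_assoc, Matrix.mul_assoc, ← Matrix.mul_assoc P, hPP]
  have e2 : V₂ᵀ * P * V₂ = (P * V₂)ᵀ * (P * V₂) := by
    rw [Matrix.transpose_mul, hPt, Matrix.mul_assoc, Matrix.mul_assoc, ← Matrix.mul_assoc P, hPP]
  have e3 : (V₁ - P * V₁)ᵀ * (V₁ - P * V₁) = 1 - V₁ᵀ * P * V₁ := by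
    rw [Matrix.transpose_sub, Matrix.sub_mul, Matrix.mul_sub, Matrix.mul_sub, ← e1, h.orth₁,
      Matrix.transpose_mul, hPt, Matrix.mul_assoc]
    simp
  have t1 : (Yᵀ * Y * P).trace
      = ∑ i, d₁ i * (V₁ᵀ * P * V₁) i i + ∑ j, d₂ j * (V₂ᵀ * P * V₂) j j := by
    have a1 : V₁ᵀ * (P * (Yᵀ * Y)) * V₁ = V₁ᵀ * P * V₁ * diagonal d₁ := by
      rw [Matrix.mul_assoc, Matrix.mul_assoc P, h.eigen₁]; simp only [Matrix.mul_assoc]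
    have a2 : V₂ᵀ * (P * (Yᵀ * Y)) * V₂ = V₂ᵀ * P * V₂ * diagonal d₂ := by
      rw [Matrix.mul_assoc, Matrix.mul_assoc P, h.eigen₂]; simp only [Matrix.mul_assoc]
    rw [Matrix.trace_mul_comm, h.trace_mul, a1, a2]
    simp only [Matrix.trace, Matrix.diag, Matrix.mul_diagonal, mul_comm]
  have t2 : P.trace = ∑ i, (V₁ᵀ * P * V₁) i i + ∑ j, (V₂ᵀ * P * V₂) j j := h.trace_mul P
  have n1 : ∀ i, 0 ≤ (d₁ i - μ) * (1 - (V₁ᵀ * P * V₁) i i) := fun i => by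
    refine mul_nonneg (sub_nonneg.2 (h.above i).le) ?_
    have := transpose_mul_self_apply_self_nonneg (V₁ - P * V₁) i
    rwa [e3, Matrix.sub_apply, Matrix.one_apply_eq] at this
  have n2 : ∀ j, 0 ≤ (μ - d₂ j) * (V₂ᵀ * P * V₂) j j := fun j => by
    refine mul_nonneg (sub_nonneg.2 (h.below j).le) ?_
    rw [e2]
    exact transpose_mul_self_apply_self_nonneg _ j
  -- The two nonnegative sums below measure how far `P` is from the spectral projection.
  have key : ∑ i, (d₁ i - μ) * (1 - (V₁ᵀ * P * V₁) i i)
      + ∑ j, (μ - d₂ j) * (V₂ᵀ * P * V₂) j j + μ * (r - P.trace)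
      = ∑ i, d₁ i - (Yᵀ * Y * P).trace := by
    rw [t1, t2]
    simp only [sub_mul, mul_sub, mul_one, Finset.sum_sub_distrib, ← Finset.mul_sum]
    simp
    ring
  have s1 := Finset.sum_nonneg fun i (_ : i ∈ Finset.univ) => n1 i
  have s2 := Finset.sum_nonneg fun j (_ : j ∈ Finset.univ) => n2 j
  have s3 : 0 ≤ μ * (r - P.trace) := mul_nonneg h.pos.le (by linarith)
  have z1 : ∀ i, (d₁ i - μ) * (1 - (V₁ᵀ * P * V₁) i i) = 0 := fun i =>
    (Finset.sum_eq_zero_iff_of_nonneg fun i _ => n1 i).1 (by linarith) i (Finset.mem_univ i)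
  have z2 : ∀ j, (μ - d₂ j) * (V₂ᵀ * P * V₂) j j = 0 := fun j =>
    (Finset.sum_eq_zero_iff_of_nonneg fun j _ => n2 j).1 (by linarith) j (Finset.mem_univ j)
  have f1 : V₁ - P * V₁ = 0 := by
    ext k i
    refine col_eq_zero_of_transpose_mul_self ?_ k
    rw [e3, Matrix.sub_apply, Matrix.one_apply_eq]
    exact (mul_eq_zero.1 (z1 i)).resolve_left (sub_pos.2 (h.above i)).ne'
  have f2 : P * V₂ = 0 := by
    ext k j
    refine col_eq_zero_of_transpose_mul_self ?_ k
    rw [← e2]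
    exact (mul_eq_zero.1 (z2 j)).resolve_left (sub_pos.2 (h.below j)).ne'
  calc P = P * (V₁ * V₁ᵀ + V₂ * V₂ᵀ) := by rw [h.complete, Matrix.mul_one]
    _ = V₁ * V₁ᵀ := by
      rw [Matrix.mul_add, ← Matrix.mul_assoc, ← Matrix.mul_assoc, f2, ← sub_eq_zero.1 f1]; simp

theorem norm_sq_mul_one_sub {P : Matrix (Fin n) (Fin n) ℝ} (hPt : Pᵀ = P) (hPP : P * P = P)
    (M : Matrix (Fin m) (Fin n) ℝ) :
    ‖M * (1 - P)‖ ^ 2 = (Mᵀ * M).trace - (Mᵀ * M * P).trace := by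
  have h1 : (1 - P) * (1 - P)ᵀ = 1 - P := by
    rw [Matrix.transpose_sub, hPt, Matrix.transpose_one, Matrix.sub_mul, Matrix.one_mul,
      Matrix.mul_sub, hPP, Matrix.mul_one, sub_self, sub_zero]
  rw [norm_sq_eq_trace, Matrix.transpose_mul, Matrix.mul_assoc, ← Matrix.mul_assoc (1 - P), h1,
    Matrix.trace_mul_comm, Matrix.mul_assoc, Matrix.trace_mul_comm, Matrix.mul_sub, Matrix.mul_one,
    Matrix.trace_sub]

/-- The Eckart–Young theorem with uniqueness: at a global minimizer the product is the truncation
`Y V₁ V₁ᵀ` of `Y`, and the rows of `B` lie in the leading singular subspace. -/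
theorem SpectralGap.eq_of_mem_minimizers (h : SpectralGap Y V₁ V₂ d₁ d₂ μ) {z : Factors m n r}
    (hz : z ∈ minimizers r Y) : z.1 * z.2 = Y * (V₁ * V₁ᵀ) ∧ z.2 * (V₁ * V₁ᵀ) = z.2 := by
  obtain ⟨A, B⟩ := z
  obtain ⟨P, hPt, hPP, hBP, hPr⟩ := exists_rowSpace_projection B
  have hEt : (V₁ * V₁ᵀ)ᵀ = V₁ * V₁ᵀ := by rw [Matrix.transpose_mul, Matrix.transpose_transpose]
  have hEE : V₁ * V₁ᵀ * (V₁ * V₁ᵀ) = V₁ * V₁ᵀ := by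
    rw [Matrix.mul_assoc, ← Matrix.mul_assoc V₁ᵀ, h.orth₁, Matrix.one_mul]
  have hEtr : (Yᵀ * Y * (V₁ * V₁ᵀ)).trace = ∑ i, d₁ i := by
    rw [← Matrix.mul_assoc, h.eigen₁, Matrix.trace_mul_comm, ← Matrix.mul_assoc, h.orth₁,
      Matrix.one_mul, Matrix.trace_diagonal]
  -- The competitor is the rank-`r` factorization of `Y V₁ V₁ᵀ`.
  have hmin : loss Y (A, B) ≤ loss Y (Y * V₁, V₁ᵀ) := hz _
  simp only [loss] at hmin
  have c1 : ‖Y * V₁ * V₁ᵀ - Y‖ ^ 2 = (Yᵀ * Y).trace - ∑ i, d₁ i := by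
    rw [← hEtr, ← norm_sq_mul_one_sub hEt hEE, Matrix.mul_sub, Matrix.mul_one, norm_sub_rev,
      Matrix.mul_assoc]
  have c2 : ‖A * B - Y‖ ^ 2
      = ‖(A * B - Y) * P‖ ^ 2 + ((Yᵀ * Y).trace - (Yᵀ * Y * P).trace) := by
    have e : (A * B - Y) * (1 - P) = -(Y * (1 - P)) := by
      rw [Matrix.sub_mul, Matrix.mul_sub, Matrix.mul_one, Matrix.mul_assoc, hBP]; simp
    have e' : ‖(A * B - Y) * P‖ ^ 2 = ((A * B - Y)ᵀ * (A * B - Y) * P).trace := by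
      rw [norm_sq_eq_trace, Matrix.transpose_mul, hPt, Matrix.mul_assoc, ← Matrix.mul_assoc P, hPP,
        Matrix.trace_mul_comm, Matrix.mul_assoc, Matrix.trace_mul_comm]
    rw [← norm_sq_mul_one_sub hPt hPP Y, ← norm_neg (Y * (1 - P)), ← e,
      norm_sq_mul_one_sub hPt hPP, e', norm_sq_eq_trace_transpose_mul]
    ring
  have hge : ∑ i, d₁ i + ‖(A * B - Y) * P‖ ^ 2 ≤ (Yᵀ * Y * P).trace := by linarith
  have hPeq := h.projection_eq hPt hPP hPr
    (by linarith [sq_nonneg ‖(A * B - Y) * P‖])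
  have hzero : (A * B - Y) * P = 0 := by
    have : (Yᵀ * Y * P).trace = ∑ i, d₁ i := by rw [hPeq, hEtr]
    have : ‖(A * B - Y) * P‖ ^ 2 ≤ 0 := by linarith
    exact norm_eq_zero.1 (pow_eq_zero_iff two_ne_zero |>.1 (le_antisymm this (sq_nonneg _)))
  rw [← hPeq]
  refine ⟨?_, hBP⟩
  rw [Matrix.sub_mul, Matrix.mul_assoc, hBP] at hzero
  exact sub_eq_zero.1 hzero

/-- Both factors of a global minimizer have full rank `r`: `A` has a left inverse and `B` has a
right inverse, which can be chosen with columns in the span of those of `V₁`. -/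
theorem SpectralGap.exists_inverses (h : SpectralGap Y V₁ V₂ d₁ d₂ μ) {z : Factors m n r}
    (hz : z ∈ minimizers r Y) :
    ∃ (L : Matrix (Fin r) (Fin m) ℝ) (K : Matrix (Fin r) (Fin r) ℝ),
      L * z.1 = 1 ∧ z.2 * (V₁ * K) = 1 := by
  obtain ⟨A, B⟩ := z
  obtain ⟨hAB, -⟩ := h.eq_of_mem_minimizers hz
  simp only at hAB ⊢
  have hunit : diagonal (fun i => (d₁ i)⁻¹) * diagonal d₁ = 1 := by
    rw [Matrix.diagonal_mul_diagonal, ← Matrix.diagonal_one]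
    congr 1; ext i
    exact inv_mul_cancel₀ (h.pos.trans (h.above i)).ne'
  have h1 : (Y * V₁)ᵀ * (A * (B * V₁)) = diagonal d₁ := by
    rw [← Matrix.mul_assoc A, hAB, Matrix.mul_assoc Y, Matrix.mul_assoc V₁, h.orth₁,
      Matrix.mul_one, Matrix.transpose_mul, Matrix.mul_assoc, ← Matrix.mul_assoc Yᵀ, h.eigen₁,
      ← Matrix.mul_assoc, h.orth₁, Matrix.one_mul]
  set N := diagonal (fun i => (d₁ i)⁻¹) * (Y * V₁)ᵀ with hN
  have h2 : N * A * (B * V₁) = 1 := by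
    rw [hN, Matrix.mul_assoc, Matrix.mul_assoc, h1, hunit]
  have h3 : B * V₁ * (N * A) = 1 := mul_eq_one_comm.1 h2
  exact ⟨B * V₁ * N, N * A, by rw [Matrix.mul_assoc]; exact h3,
    by rw [← Matrix.mul_assoc]; exact h3⟩

end

/-! ### Minimizers form a `GL(r)`-orbit -/

section
variable {m n r s : ℕ} {Y : Matrix (Fin m) (Fin n) ℝ} {V₁ : Matrix (Fin n) (Fin r) ℝ}
  {V₂ : Matrix (Fin n) (Fin s) ℝ} {d₁ : Fin r → ℝ} {d₂ : Fin s → ℝ} {μ : ℝ}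

theorem loss_eq_of_mem_orbit {x z : Factors m n r} (hx : x ∈ orbit z) : loss Y x = loss Y z := by
  obtain ⟨Q, rfl⟩ := hx
  simp only [loss]
  rw [Matrix.mul_assoc, ← Matrix.mul_assoc (Q : Matrix (Fin r) (Fin r) ℝ), ← Units.val_mul,
    mul_inv_cancel, Units.val_one, Matrix.one_mul]

/-- Two full-rank factorizations of the same matrix differ by an element of `GL(r)`. -/
theorem mem_orbit_of_mul_eq {x z : Factors m n r} {L L' : Matrix (Fin r) (Fin m) ℝ}
    {K K' : Matrix (Fin n) (Fin r) ℝ} (hL : L * z.1 = 1) (hK : z.2 * K = 1) (hL' : L' * x.1 = 1)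
    (hK' : x.2 * K' = 1) (h : x.1 * x.2 = z.1 * z.2) : x ∈ orbit z := by
  obtain ⟨A, B⟩ := z
  obtain ⟨A', B'⟩ := x
  simp only at hL hK hL' hK' h
  have hB : B = L * A' * B' := by rw [Matrix.mul_assoc, h, ← Matrix.mul_assoc, hL, Matrix.one_mul]
  have hB' : B * K' * B' = B := by
    calc B * K' * B' = L * A' * (B' * K') * B' := by
          conv_lhs => rw [hB]
          simp only [Matrix.mul_assoc]
      _ = B := by rw [hK', Matrix.mul_one, ← hB]
  have h1 : B * K' * (B' * K) = 1 := by rw [← Matrix.mul_assoc, hB', hK]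
  have h2 : B' * K * (B * K') = 1 := mul_eq_one_comm.1 h1
  refine ⟨⟨B * K', B' * K, h1, h2⟩, Prod.ext ?_ ?_⟩
  · change A * (B * K') = A'
    rw [← Matrix.mul_assoc, ← h, Matrix.mul_assoc, hK', Matrix.mul_one]
  · change B' * K * B = B'
    rw [← hB', ← Matrix.mul_assoc, h2, Matrix.one_mul]

theorem SpectralGap.minimizers_eq_orbit (h : SpectralGap Y V₁ V₂ d₁ d₂ μ) {z : Factors m n r}
    (hz : z ∈ minimizers r Y) : minimizers r Y = orbit z := by
  ext x
  constructor
  · intro hx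
    obtain ⟨L, K, hL, hK⟩ := h.exists_inverses hz
    obtain ⟨L', K', hL', hK'⟩ := h.exists_inverses hx
    refine mem_orbit_of_mul_eq hL hK hL' hK' ?_
    rw [(h.eq_of_mem_minimizers hx).1, (h.eq_of_mem_minimizers hz).1]
  · intro hx y
    rw [loss_eq_of_mem_orbit hx]
    exact hz y

/-! ### Kernel of the linearized gradient -/

/-- The critical point equations linearized at a minimizer are solved only by the infinitesimal
`GL(r)`-action. With `R = A B - Y` and `M = P B + A Q`, the linearized equations give the Sylvester
equation `M (A B)ᵀ (A B) = R Rᵀ M`, and the spectra of `(A B)ᵀ (A B)` and `R Rᵀ` are separated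
by `μ`. -/
theorem SpectralGap.exists_generator (h : SpectralGap Y V₁ V₂ d₁ d₂ μ) {z : Factors m n r}
    (hz : z ∈ minimizers r Y) {u : Factors m n r}
    (h₁ : (u.1 * z.2 + z.1 * u.2) * z.2ᵀ + (z.1 * z.2 - Y) * u.2ᵀ = 0)
    (h₂ : z.1ᵀ * (u.1 * z.2 + z.1 * u.2) + u.1ᵀ * (z.1 * z.2 - Y) = 0) :
    ∃ X : Matrix (Fin r) (Fin r) ℝ, u = (z.1 * X, -(X * z.2)) := by
  obtain ⟨L, K, hL, hK⟩ := h.exists_inverses hz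
  obtain ⟨hW, hB⟩ := h.eq_of_mem_minimizers hz
  obtain ⟨A, B⟩ := z
  obtain ⟨P, Q⟩ := u
  simp only at hL hK hW hB h₁ h₂ ⊢
  set R := A * B - Y with hR
  set M := P * B + A * Q with hM
  have hR' : R = -(Y * V₂ * V₂ᵀ) := by
    have : Y = Y * (V₁ * V₁ᵀ) + Y * V₂ * V₂ᵀ := by
      rw [Matrix.mul_assoc Y V₂, ← Matrix.mul_add, h.complete, Matrix.mul_one]
    rw [hR, hW]
    nth_rw 2 [this]
    abel
  have hRV : R * V₁ = 0 := by
    rw [hR', Matrix.neg_mul, Matrix.mul_assoc, h.orth₂₁, Matrix.mul_zero, neg_zero]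
  have hRB : R * Bᵀ = 0 := by
    rw [← hB, Matrix.transpose_mul, Matrix.transpose_mul, Matrix.transpose_transpose,
      Matrix.mul_assoc V₁, ← Matrix.mul_assoc R, hRV, Matrix.zero_mul]
  have hWV : A * B * V₁ = Y * V₁ := by
    rw [hW, Matrix.mul_assoc, Matrix.mul_assoc, h.orth₁, Matrix.mul_one]
  have hRYV : Rᵀ * (Y * V₁) = 0 := by
    rw [hR', Matrix.transpose_neg, Matrix.transpose_mul, Matrix.transpose_mul,
      Matrix.transpose_transpose, Matrix.neg_mul, Matrix.mul_assoc, Matrix.mul_assoc,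
      ← Matrix.mul_assoc Yᵀ, h.eigen₁, ← Matrix.mul_assoc V₂ᵀ, h.orth₂₁]
    simp
  have hRA : Rᵀ * A = 0 := by
    calc Rᵀ * A = Rᵀ * (A * B * V₁) * K := by
          rw [Matrix.mul_assoc, Matrix.mul_assoc, Matrix.mul_assoc, hK, Matrix.mul_one]
      _ = 0 := by rw [hWV, hRYV, Matrix.zero_mul]
  have hWWV : (A * B)ᵀ * (A * B) * V₁ = V₁ * diagonal d₁ := by
    rw [Matrix.mul_assoc, hWV, hW, Matrix.transpose_mul, Matrix.transpose_mul,
      Matrix.transpose_transpose, Matrix.mul_assoc, ← Matrix.mul_assoc Yᵀ, h.eigen₁,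
      Matrix.mul_assoc V₁, ← Matrix.mul_assoc V₁ᵀ, h.orth₁, Matrix.one_mul]
  have hRR : V₂ᵀ * (Rᵀ * R) = diagonal d₂ * V₂ᵀ := by
    have e : V₂ᵀ * (Yᵀ * Y) = diagonal d₂ * V₂ᵀ := by
      have := congrArg Matrix.transpose h.eigen₂
      simpa [Matrix.transpose_mul, Matrix.mul_assoc] using this
    rw [hR', Matrix.transpose_neg, Matrix.neg_mul, Matrix.mul_neg (Y * V₂ * V₂ᵀ)ᵀ, neg_neg]
    calc V₂ᵀ * ((Y * V₂ * V₂ᵀ)ᵀ * (Y * V₂ * V₂ᵀ))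
        = (V₂ᵀ * V₂) * (V₂ᵀ * (Yᵀ * Y)) * V₂ * V₂ᵀ := by
          simp only [Matrix.transpose_mul, Matrix.transpose_transpose, Matrix.mul_assoc]
      _ = diagonal d₂ * V₂ᵀ := by
          rw [e, h.orth₂, Matrix.one_mul, Matrix.mul_assoc (diagonal d₂), h.orth₂, Matrix.mul_one]
  have hRM : Rᵀ * M = Rᵀ * P * B := by
    rw [hM, Matrix.mul_add, ← Matrix.mul_assoc Rᵀ A, hRA, Matrix.zero_mul, add_zero,
      Matrix.mul_assoc]
  have E1 : M * (A * B)ᵀ = -(R * Mᵀ) := by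
    have : R * Mᵀ = R * Qᵀ * Aᵀ := by
      rw [hM, Matrix.transpose_add, Matrix.mul_add, Matrix.transpose_mul, ← Matrix.mul_assoc,
        hRB, Matrix.zero_mul, zero_add, Matrix.transpose_mul, Matrix.mul_assoc]
    rw [this, Matrix.transpose_mul, ← Matrix.mul_assoc, eq_neg_of_add_eq_zero_left h₁,
      Matrix.neg_mul]
  have E2 : Mᵀ * A = -(Rᵀ * P) := by
    have := congrArg Matrix.transpose (eq_neg_of_add_eq_zero_left h₂)
    simpa [Matrix.transpose_mul] using this
  have E3 : M * ((A * B)ᵀ * (A * B)) = R * (Rᵀ * M) := by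
    rw [← Matrix.mul_assoc, E1, Matrix.neg_mul, Matrix.mul_assoc, ← Matrix.mul_assoc Mᵀ, E2,
      Matrix.neg_mul, Matrix.mul_neg, neg_neg, hRM]
  have cancel : ∀ {p : ℕ} (N : Matrix (Fin p) (Fin r) ℝ), N * diagonal d₁ = 0 → N = 0 := by
    intro p N hN
    ext k i
    have := congrFun (congrFun hN k) i
    rw [Matrix.mul_diagonal] at this
    exact (mul_eq_zero.1 this).resolve_right (h.pos.trans (h.above i)).ne'
  set G := Rᵀ * M * V₁ with hG
  have E4 : M * V₁ * diagonal d₁ = R * G := by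
    rw [Matrix.mul_assoc, ← hWWV, ← Matrix.mul_assoc, E3, hG]
    simp only [Matrix.mul_assoc]
  have E5 : G * diagonal d₁ = Rᵀ * R * G := by
    rw [Matrix.mul_assoc Rᵀ R, ← E4, hG]
    simp only [Matrix.mul_assoc]
  -- Entrywise, the Sylvester equation reads `(V₂ᵀ G)ⱼᵢ (d₁ i - d₂ j) = 0`.
  have E6 : V₂ᵀ * G = 0 := by
    have e : V₂ᵀ * G * diagonal d₁ = diagonal d₂ * (V₂ᵀ * G) := by
      rw [Matrix.mul_assoc, E5, ← Matrix.mul_assoc, hRR, Matrix.mul_assoc]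
    ext j i
    have := congrFun (congrFun e j) i
    rw [Matrix.mul_diagonal, Matrix.diagonal_mul] at this
    have h' : (V₂ᵀ * G) j i * (d₁ i - d₂ j) = 0 := by rw [mul_sub, this]; ring
    exact (mul_eq_zero.1 h').resolve_right (sub_pos.2 ((h.below j).trans (h.above i))).ne'
  have hRG : R * G = 0 := by
    rw [hR', Matrix.neg_mul, Matrix.mul_assoc, E6, Matrix.mul_zero, neg_zero]
  have hG0 : G = 0 := cancel G (by rw [E5, Matrix.mul_assoc, hRG, Matrix.mul_zero])
  have hMV : M * V₁ = 0 := cancel _ (by rw [E4, hRG])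
  have hRP : Rᵀ * P = 0 := by
    calc Rᵀ * P = G * K := by
          rw [hG, hRM, Matrix.mul_assoc, Matrix.mul_assoc, hK, Matrix.mul_one]
      _ = 0 := by rw [hG0, Matrix.zero_mul]
  have hAM : Aᵀ * M = 0 := by
    have := congrArg Matrix.transpose E2
    rw [hRP, neg_zero, Matrix.transpose_zero, Matrix.transpose_mul,
      Matrix.transpose_transpose] at this
    exact this
  have hP : P = A * -(Q * (V₁ * K)) := by
    have e : M * (V₁ * K) = 0 := by rw [← Matrix.mul_assoc, hMV, Matrix.zero_mul]
    rw [hM, Matrix.add_mul, Matrix.mul_assoc, hK, Matrix.mul_one, Matrix.mul_assoc] at e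
    rw [eq_neg_of_add_eq_zero_left e, Matrix.mul_neg]
  set X := -(Q * (V₁ * K)) with hX
  refine ⟨X, Prod.ext hP ?_⟩
  have e1 : M = A * (X * B + Q) := by rw [hM, hP, Matrix.mul_add, Matrix.mul_assoc]
  have e2 : A * (X * B + Q) = 0 := by
    rw [← Matrix.conjTranspose_mul_self_mul_eq_zero, Matrix.conjTranspose_eq_transpose_of_trivial,
      Matrix.mul_assoc, ← e1, hAM]
  have e3 : X * B + Q = 0 := by
    rw [← Matrix.one_mul (X * B + Q), ← hL, Matrix.mul_assoc, e2, Matrix.mul_zero]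
  exact eq_neg_of_add_eq_zero_right e3

end

/-! ### Frobenius inner product and derivatives of the loss -/

theorem trace_mul_transpose_comm {p q : ℕ} (M N : Matrix (Fin p) (Fin q) ℝ) :
    (M * Nᵀ).trace = (N * Mᵀ).trace := by
  rw [← Matrix.trace_transpose, Matrix.transpose_mul, Matrix.transpose_transpose]

theorem norm_add_sq_eq {p q : ℕ} (M N : Matrix (Fin p) (Fin q) ℝ) :
    ‖M + N‖ ^ 2 = ‖M‖ ^ 2 + 2 * (M * Nᵀ).trace + ‖N‖ ^ 2 := by
  simp only [norm_sq_eq_trace, Matrix.transpose_add, Matrix.add_mul, Matrix.mul_add,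
    Matrix.trace_add, trace_mul_transpose_comm N M]
  ring

theorem trace_mul_transpose_le {p q : ℕ} (M N : Matrix (Fin p) (Fin q) ℝ) :
    (M * Nᵀ).trace ≤ ‖M‖ * ‖N‖ := by
  have h1 := norm_add_sq_eq M N
  have h2 : ‖M + N‖ ^ 2 ≤ (‖M‖ + ‖N‖) ^ 2 := by gcongr; exact norm_add_le M N
  nlinarith

/-- Frobenius inner product with a fixed pair of factors, as a continuous linear form. -/
noncomputable def pairing {m n r : ℕ} (v : Factors m n r) : Factors m n r →L[ℝ] ℝ :=
  LinearMap.toContinuousLinearMap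
    { toFun := fun w => (w.1 * v.1ᵀ).trace + (w.2 * v.2ᵀ).trace
      map_add' := fun a b => by
        simp only [Prod.fst_add, Prod.snd_add, Matrix.add_mul, Matrix.trace_add]; ring
      map_smul' := fun c a => by
        simp only [Prod.smul_fst, Prod.smul_snd, Matrix.smul_mul, Matrix.trace_smul,
          RingHom.id_apply, smul_add] }

theorem pairing_apply {m n r : ℕ} (v w : Factors m n r) :
    pairing v w = (w.1 * v.1ᵀ).trace + (w.2 * v.2ᵀ).trace := rfl

theorem pairing_self {m n r : ℕ} (v : Factors m n r) : pairing v v = ‖v.1‖ ^ 2 + ‖v.2‖ ^ 2 := by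
  rw [pairing_apply, norm_sq_eq_trace, norm_sq_eq_trace]

theorem isBoundedBilinearMap_matrix_mul (p q l : ℕ) :
    IsBoundedBilinearMap ℝ
      (fun x : Matrix (Fin p) (Fin q) ℝ × Matrix (Fin q) (Fin l) ℝ => x.1 * x.2) where
  add_left := fun a b c => Matrix.add_mul a b c
  smul_left := fun c a b => Matrix.smul_mul c a b
  add_right := fun a b c => Matrix.mul_add a b c
  smul_right := fun c a b => Matrix.mul_smul a c b
  bound := ⟨1, one_pos, fun a b => by rw [one_mul]; exact Matrix.frobenius_norm_mul a b⟩

theorem hasFDerivAt_matrix_mul {E : Type*} [NormedAddCommGroup E] [NormedSpace ℝ E] {p q l : ℕ}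
    {f : E → Matrix (Fin p) (Fin q) ℝ} {g : E → Matrix (Fin q) (Fin l) ℝ}
    {f' : E →L[ℝ] Matrix (Fin p) (Fin q) ℝ} {g' : E →L[ℝ] Matrix (Fin q) (Fin l) ℝ} {x : E}
    (hf : HasFDerivAt f f' x) (hg : HasFDerivAt g g' x) :
    ∃ D : E →L[ℝ] Matrix (Fin p) (Fin l) ℝ, (∀ u, D u = f x * g' u + f' u * g x) ∧
      HasFDerivAt (fun y => f y * g y) D x := by
  have hb := isBoundedBilinearMap_matrix_mul p q l
  have h := HasFDerivAt.comp x (hb.hasFDerivAt (f x, g x)) (hf.prodMk hg)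
  exact ⟨_, fun u => hb.deriv_apply (f x, g x) (f' u, g' u), h⟩

/-- Transposition as a continuous linear map. -/
noncomputable def transposeCLM (p q : ℕ) :
    Matrix (Fin p) (Fin q) ℝ →L[ℝ] Matrix (Fin q) (Fin p) ℝ :=
  LinearMap.toContinuousLinearMap (Matrix.transposeLinearEquiv (Fin p) (Fin q) ℝ ℝ).toLinearMap

section
variable {m n r : ℕ} (Y : Matrix (Fin m) (Fin n) ℝ)

theorem hasFDerivAt_residual (x : Factors m n r) :
    ∃ D : Factors m n r →L[ℝ] Matrix (Fin m) (Fin n) ℝ, (∀ u, D u = u.1 * x.2 + x.1 * u.2) ∧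
      HasFDerivAt (fun y : Factors m n r => y.1 * y.2 - Y) D x := by
  obtain ⟨D, hD, h⟩ := hasFDerivAt_matrix_mul (hasFDerivAt_fst (𝕜 := ℝ) (p := x))
    (hasFDerivAt_snd (𝕜 := ℝ) (p := x))
  exact ⟨D, fun u => (hD u).trans (add_comm _ _), h.sub_const Y⟩

/-- The derivative of the gradient, that is, the Hessian as a linear map. -/
theorem exists_hasFDerivAt_grad (x : Factors m n r) :
    ∃ D : Factors m n r →L[ℝ] Factors m n r,
      (∀ u, D u = ((u.1 * x.2 + x.1 * u.2) * x.2ᵀ + (x.1 * x.2 - Y) * u.2ᵀ,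
        x.1ᵀ * (u.1 * x.2 + x.1 * u.2) + u.1ᵀ * (x.1 * x.2 - Y))) ∧
      HasFDerivAt (fun y => (gradA Y y, gradB Y y)) D x := by
  obtain ⟨DR, hDR, hR⟩ := hasFDerivAt_residual Y x
  obtain ⟨D₁, hD₁, h₁⟩ := hasFDerivAt_matrix_mul hR
    ((transposeCLM r n).hasFDerivAt.comp x (hasFDerivAt_snd (𝕜 := ℝ) (p := x)))
  obtain ⟨D₂, hD₂, h₂⟩ := hasFDerivAt_matrix_mul
    ((transposeCLM m r).hasFDerivAt.comp x (hasFDerivAt_fst (𝕜 := ℝ) (p := x))) hR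
  refine ⟨D₁.prod D₂, fun u => Prod.ext ?_ ?_, h₁.prodMk h₂⟩
  · exact (hD₁ u).trans ((add_comm _ _).trans
      (congrArg (fun N => N * x.2ᵀ + (x.1 * x.2 - Y) * u.2ᵀ) (hDR u)))
  · exact (hD₂ u).trans
      (congrArg (fun N => x.1ᵀ * N + u.1ᵀ * (x.1 * x.2 - Y)) (hDR u))

theorem differentiableAt_loss (x : Factors m n r) : DifferentiableAt ℝ (loss Y) x := by
  obtain ⟨DR, -, hR⟩ := hasFDerivAt_residual Y x
  obtain ⟨D, -, h⟩ := hasFDerivAt_matrix_mul hR ((transposeCLM m n).hasFDerivAt.comp x hR)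
  have ht := (LinearMap.toContinuousLinearMap (Matrix.traceLinearMap (Fin m) ℝ ℝ)).hasFDerivAt.comp
    x h
  have he : loss Y = fun y : Factors m n r => 1 / 2 *
      (((LinearMap.toContinuousLinearMap (Matrix.traceLinearMap (Fin m) ℝ ℝ)) ∘
        fun y : Factors m n r => (y.1 * y.2 - Y) *
          ((transposeCLM m n) ∘ fun y : Factors m n r => y.1 * y.2 - Y) y) y) := by
    funext y
    rw [loss, norm_sq_eq_trace]
    rfl
  rw [he]
  exact ht.differentiableAt.const_mul _

theorem hasDerivAt_add_smul (x u : Factors m n r) :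
    HasDerivAt (fun s : ℝ => x + s • u) u 0 :=
  (((hasDerivAt_id (0 : ℝ)).smul_const u).const_add x).congr_deriv (one_smul ℝ u)

theorem hasFDerivAt_loss (x : Factors m n r) :
    HasFDerivAt (loss Y) (pairing (gradA Y x, gradB Y x)) x := by
  have h := (differentiableAt_loss Y x).hasFDerivAt
  refine h.congr_fderiv (ContinuousLinearMap.ext fun v => ?_)
  have hx : x + (0 : ℝ) • v = x := by rw [zero_smul, add_zero]
  have h2 : HasDerivAt (fun s : ℝ => loss Y (x + s • v)) (fderiv ℝ (loss Y) x v) 0 :=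
    HasFDerivAt.comp_hasDerivAt (l := loss Y) (l' := fderiv ℝ (loss Y) x) (0 : ℝ)
      (hx.symm ▸ h) (hasDerivAt_add_smul x v)
  rw [h2.unique (hasDerivAt_loss Y x v), pairing_apply, trace_mul_transpose_comm v.1,
    trace_mul_transpose_comm v.2]

theorem hessian_eq_pairing {x : Factors m n r} {D : Factors m n r →L[ℝ] Factors m n r}
    (hD : HasFDerivAt (fun y => (gradA Y y, gradB Y y)) D x) (u v : Factors m n r) :
    hessian Y x u v = pairing v (D u) := by
  have hx : x + (0 : ℝ) • u = x := by rw [zero_smul, add_zero]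
  have h2 : HasDerivAt (fun s : ℝ => (gradA Y (x + s • u), gradB Y (x + s • u))) (D u) 0 :=
    HasFDerivAt.comp_hasDerivAt (0 : ℝ) (hx.symm ▸ hD) (hasDerivAt_add_smul x u)
  have h3 := (pairing v).hasFDerivAt.comp_hasDerivAt (0 : ℝ) h2
  have h4 : (fun s : ℝ => deriv (fun t : ℝ => loss Y (x + s • u + t • v)) 0) =
      fun s : ℝ => pairing v (gradA Y (x + s • u), gradB Y (x + s • u)) :=
    funext fun s => (hasDerivAt_loss Y (x + s • u) v).deriv
  rw [hessian, h4]
  exact h3.deriv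

theorem mem_hessianKer_iff {x : Factors m n r} {D : Factors m n r →L[ℝ] Factors m n r}
    (hD : HasFDerivAt (fun y => (gradA Y y, gradB Y y)) D x) (u : Factors m n r) :
    u ∈ hessianKer Y x ↔ D u = 0 := by
  constructor
  · intro h
    have h1 := h (D u)
    rw [hessian_eq_pairing Y hD, pairing_self] at h1
    refine Prod.ext (norm_eq_zero.1 ?_) (norm_eq_zero.1 ?_) <;>
      nlinarith [sq_nonneg ‖(D u).1‖, sq_nonneg ‖(D u).2‖]
  · intro h v
    rw [hessian_eq_pairing Y hD, h, map_zero]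

variable {Y}

theorem grad_eq_zero_of_mem_minimizers {z : Factors m n r} (hz : z ∈ minimizers r Y) :
    gradA Y z = 0 ∧ gradB Y z = 0 := by
  have h : pairing (gradA Y z, gradB Y z) = 0 :=
    IsLocalMin.hasFDerivAt_eq_zero (Eventually.of_forall hz) (hasFDerivAt_loss Y z)
  have h1 := pairing_self (gradA Y z, gradB Y z)
  rw [h] at h1
  simp only [_root_.zero_apply] at h1
  constructor <;> refine norm_eq_zero.1 ?_ <;>
      nlinarith [sq_nonneg ‖gradA Y z‖, sq_nonneg ‖gradB Y z‖]

/-! ### Tangent space of the orbit -/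

/-- The curve `s ↦ (A exp(sX), exp(-sX) B)` realizes the infinitesimal action of `X`. -/
theorem generator_mem_tangentVectors (z : Factors m n r) (X : Matrix (Fin r) (Fin r) ℝ) :
    (z.1 * X, -(X * z.2)) ∈ tangentVectors (orbit z) z := by
  have hexp : ∀ X : Matrix (Fin r) (Fin r) ℝ,
      HasDerivAt (fun s : ℝ => NormedSpace.exp (s • X)) X 0 := fun X =>
    (hasDerivAt_exp_smul_const (𝕂 := ℝ) X 0).congr_deriv (by simp)
  refine ⟨fun s => (z.1 * NormedSpace.exp (s • X), NormedSpace.exp (s • -X) * z.2), ?_, ?_, ?_⟩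
  · simp
  · refine Eventually.of_forall fun s => ?_
    have hinv : NormedSpace.exp (s • X) * NormedSpace.exp (s • -X) = 1 := by
      rw [smul_neg, Matrix.exp_neg]
      exact Matrix.mul_nonsing_inv _ ((Matrix.isUnit_iff_isUnit_det _).1 (Matrix.isUnit_exp _))
    exact ⟨⟨NormedSpace.exp (s • X), NormedSpace.exp (s • -X), hinv, mul_eq_one_comm.1 hinv⟩, rfl⟩
  · have h1 := HasFDerivAt.comp_hasDerivAt (0 : ℝ)
      ((isBoundedBilinearMap_matrix_mul m r r).hasFDerivAt (z.1, NormedSpace.exp ((0 : ℝ) • X)))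
      ((hasDerivAt_const (0 : ℝ) z.1).prodMk (hexp X))
    have h2 := HasFDerivAt.comp_hasDerivAt (0 : ℝ)
      ((isBoundedBilinearMap_matrix_mul r r n).hasFDerivAt (NormedSpace.exp ((0 : ℝ) • -X), z.2))
      ((hexp (-X)).prodMk (hasDerivAt_const (0 : ℝ) z.2))
    refine (h1.prodMk h2).congr_deriv (Prod.ext ?_ ?_)
    · exact ((isBoundedBilinearMap_matrix_mul m r r).deriv_apply _ _).trans (by simp)
    · exact ((isBoundedBilinearMap_matrix_mul r r n).deriv_apply _ _).trans (by simp)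

/-- The Morse–Bott property: the kernel of the Hessian consists of orbit directions only. -/
theorem hessianKer_eq_tangentVectors {s : ℕ} {V₁ : Matrix (Fin n) (Fin r) ℝ}
    {V₂ : Matrix (Fin n) (Fin s) ℝ} {d₁ : Fin r → ℝ} {d₂ : Fin s → ℝ} {μ : ℝ}
    (h : SpectralGap Y V₁ V₂ d₁ d₂ μ) {z : Factors m n r} (hz : z ∈ minimizers r Y) :
    hessianKer Y z = tangentVectors (orbit z) z := by
  obtain ⟨D, hDu, hD⟩ := exists_hasFDerivAt_grad Y z
  ext u
  rw [mem_hessianKer_iff Y hD]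
  constructor
  · intro hu
    rw [hDu] at hu
    obtain ⟨X, rfl⟩ := h.exists_generator hz (congrArg Prod.fst hu) (congrArg Prod.snd hu)
    exact generator_mem_tangentVectors z X
  · rintro ⟨γ, rfl, hγ, hd⟩
    have h1 := HasFDerivAt.comp_hasDerivAt (0 : ℝ) hD hd
    -- The gradient vanishes along curves of minimizers.
    refine h1.unique ((hasDerivAt_const (0 : ℝ) (0 : Factors m n r)).congr_of_eventuallyEq ?_)
    filter_upwards [hγ] with t ht
    rw [← h.minimizers_eq_orbit hz] at ht
    exact Prod.ext (grad_eq_zero_of_mem_minimizers ht).1 (grad_eq_zero_of_mem_minimizers ht).2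

end

/-! ### Transversal slice and the Łojasiewicz inequality -/

section
variable {m n r s : ℕ} {Y : Matrix (Fin m) (Fin n) ℝ} {V₁ : Matrix (Fin n) (Fin r) ℝ}
  {V₂ : Matrix (Fin n) (Fin s) ℝ} {d₁ : Fin r → ℝ} {d₂ : Fin s → ℝ} {μ : ℝ}

/-- On the affine slice `{y | L y.1 = 1}`, which is transversal to the orbit, the gradient grows at
least linearly with the distance to the minimizer: the Hessian is injective on the directions of
the slice. -/
theorem SpectralGap.exists_norm_sub_le_on_slice (h : SpectralGap Y V₁ V₂ d₁ d₂ μ)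
    {z : Factors m n r} (hz : z ∈ minimizers r Y) {L : Matrix (Fin r) (Fin m) ℝ}
    (hL : L * z.1 = 1) :
    ∃ c : ℝ, 0 < c ∧ ∀ᶠ y : Factors m n r in 𝓝 z, L * y.1 = 1 →
      ‖y - z‖ ≤ c * ‖(gradA Y y, gradB Y y)‖ := by
  obtain ⟨D, hDu, hD⟩ := exists_hasFDerivAt_grad Y z
  let Φ : Factors m n r →ₗ[ℝ] Factors m n r × Matrix (Fin r) (Fin r) ℝ :=
    { toFun := fun u => (D u, L * u.1)
      map_add' := fun a b => by simp [Matrix.mul_add]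
      map_smul' := fun c a => by simp }
  have hker : LinearMap.ker Φ = ⊥ := by
    rw [LinearMap.ker_eq_bot']
    intro u hu
    have h1 : D u = 0 := congrArg Prod.fst hu
    have h2 : L * u.1 = 0 := congrArg Prod.snd hu
    rw [hDu] at h1
    obtain ⟨X, rfl⟩ := h.exists_generator hz (congrArg Prod.fst h1) (congrArg Prod.snd h1)
    simp only at h2
    rw [← Matrix.mul_assoc, hL, Matrix.one_mul] at h2
    simp [h2]
  obtain ⟨K, -, hK⟩ := Φ.exists_antilipschitzWith hker
  have hK' : ∀ u : Factors m n r, L * u.1 = 0 → ‖u‖ ≤ K * ‖D u‖ := fun u hu => by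
    have h1 := hK.le_mul_dist u 0
    rw [map_zero, dist_zero_right, dist_zero_right] at h1
    have h2 : Φ u = (D u, 0) := Prod.ext rfl hu
    have h3 : ‖((D u, 0) : Factors m n r × Matrix (Fin r) (Fin r) ℝ)‖ = ‖D u‖ :=
      (Prod.norm_mk _ _).trans (by rw [norm_zero, max_eq_left (norm_nonneg _)])
    rw [h2] at h1
    exact h1.trans_eq (congrArg _ h3)
  have hK0 : (0 : ℝ) ≤ K := K.2
  refine ⟨2 * K + 1, by positivity, ?_⟩
  have ho := hD.isLittleO.def (c := 1 / (2 * (K + 1))) (by positivity)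
  filter_upwards [ho] with y hy hLy
  obtain ⟨hA, hB⟩ := grad_eq_zero_of_mem_minimizers hz
  have h0 : ((gradA Y z, gradB Y z) : Factors m n r) = 0 := Prod.ext hA hB
  rw [h0, sub_zero] at hy
  have h1 := hK' (y - z) (by rw [Prod.fst_sub, Matrix.mul_sub, hLy, hL, sub_self])
  have h2 : ‖D (y - z)‖ ≤ ‖(gradA Y y, gradB Y y)‖ + 1 / (2 * (K + 1)) * ‖y - z‖ := by
    have h3 := norm_sub_le ((gradA Y y, gradB Y y) : Factors m n r)
      ((gradA Y y, gradB Y y) - D (y - z))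
    rw [sub_sub_cancel] at h3
    exact h3.trans (add_le_add le_rfl hy)
  have h3 : K * (1 / (2 * (K + 1)) * ‖y - z‖) ≤ 1 / 2 * ‖y - z‖ := by
    rw [← mul_assoc]
    refine mul_le_mul_of_nonneg_right ?_ (norm_nonneg _)
    rw [mul_one_div, div_le_div_iff₀ (by positivity) two_pos]
    linarith
  have h4 := mul_le_mul_of_nonneg_left h2 hK0
  have h5 := norm_nonneg ((gradA Y y, gradB Y y) : Factors m n r)
  nlinarith

/-- Near a minimizer the excess loss is at most quadratic in the distance. -/
theorem exists_loss_sub_le {z : Factors m n r} (hz : z ∈ minimizers r Y) :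
    ∃ c : ℝ, 0 < c ∧ ∀ᶠ y : Factors m n r in 𝓝 z, loss Y y - loss Y z ≤ c * ‖y - z‖ ^ 2 := by
  obtain ⟨hA, hB⟩ := grad_eq_zero_of_mem_minimizers hz
  refine ⟨‖z.1 * z.2 - Y‖ + (‖z.2‖ + ‖z.1‖ + 1) ^ 2, by positivity, ?_⟩
  filter_upwards [Metric.ball_mem_nhds z one_pos] with y hy
  rw [Metric.mem_ball, dist_eq_norm] at hy
  obtain ⟨u, rfl⟩ : ∃ u, y = z + u := ⟨y - z, by abel⟩
  rw [add_sub_cancel_left] at hy ⊢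
  obtain ⟨A, B⟩ := z
  obtain ⟨P, Q⟩ := u
  simp only [loss, gradA, gradB, Prod.mk_add_mk] at hA hB ⊢
  set R := A * B - Y with hR
  set ε := ‖((P, Q) : Factors m n r)‖ with hε
  have hP : ‖P‖ ≤ ε := norm_fst_le ((P, Q) : Factors m n r)
  have hQ : ‖Q‖ ≤ ε := norm_snd_le ((P, Q) : Factors m n r)
  have hε0 : 0 ≤ ε := norm_nonneg _
  have e : (A + P) * (B + Q) - Y = R + (P * B + A * Q + P * Q) := by
    rw [hR, Matrix.add_mul, Matrix.mul_add, Matrix.mul_add]; abel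
  have hN : ‖P * B + A * Q + P * Q‖ ≤ (‖B‖ + ‖A‖ + 1) * ε := by
    have h1 : ‖P * B‖ ≤ ε * ‖B‖ := (Matrix.frobenius_norm_mul P B).trans (by gcongr)
    have h2 : ‖A * Q‖ ≤ ‖A‖ * ε := (Matrix.frobenius_norm_mul A Q).trans (by gcongr)
    have h3 : ‖P * Q‖ ≤ 1 * ε :=
      (Matrix.frobenius_norm_mul P Q).trans
        (mul_le_mul (hP.trans hy.le) hQ (norm_nonneg _) one_pos.le)
    calc _ ≤ ‖P * B‖ + ‖A * Q‖ + ‖P * Q‖ := norm_add₃_le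
      _ ≤ _ := by linarith
  have ht : (R * (P * B + A * Q + P * Q)ᵀ).trace ≤ ‖R‖ * ε ^ 2 := by
    -- The linear terms pair to zero with the residual, because the gradient vanishes.
    have h1 : (R * (P * B)ᵀ).trace = 0 := by
      rw [Matrix.transpose_mul, ← Matrix.mul_assoc, hA, Matrix.zero_mul, Matrix.trace_zero]
    have h2 : (R * (A * Q)ᵀ).trace = 0 := by
      rw [Matrix.transpose_mul, ← Matrix.mul_assoc, Matrix.trace_mul_comm, ← Matrix.mul_assoc, hB,
        Matrix.zero_mul, Matrix.trace_zero]
    rw [Matrix.transpose_add, Matrix.transpose_add, Matrix.mul_add, Matrix.mul_add,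
      Matrix.trace_add, Matrix.trace_add, h1, h2, zero_add, zero_add]
    refine (trace_mul_transpose_le _ _).trans (mul_le_mul_of_nonneg_left ?_ (norm_nonneg _))
    refine (Matrix.frobenius_norm_mul P Q).trans ?_
    rw [sq]
    exact mul_le_mul hP hQ (norm_nonneg _) hε0
  have hN2 := pow_le_pow_left₀ (norm_nonneg _) hN 2
  rw [e, norm_add_sq_eq]
  rw [mul_pow] at hN2
  nlinarith [sq_nonneg ((‖B‖ + ‖A‖ + 1) * ε)]

/-- The representative `(A g⁻¹, g B)`, `g = L A`, of the orbit of `(A, B)` in the slice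
`{y | L y.1 = 1}` (meaningful when `g` is invertible). -/
noncomputable def sliceRep (L : Matrix (Fin r) (Fin m) ℝ) (x : Factors m n r) : Factors m n r :=
  (x.1 * (L * x.1)⁻¹, L * x.1 * x.2)

theorem tendsto_inv_mul {z : Factors m n r} {L : Matrix (Fin r) (Fin m) ℝ} (hL : L * z.1 = 1) :
    Tendsto (fun x : Factors m n r => (L * x.1)⁻¹) (𝓝 z) (𝓝 1) := by
  have hg : Continuous fun x : Factors m n r => L * x.1 :=
    continuous_const.matrix_mul continuous_fst
  have hdet : Tendsto (fun x : Factors m n r => Ring.inverse (L * x.1).det) (𝓝 z) (𝓝 1) := by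
    have h1 : Tendsto (fun x : Factors m n r => (L * x.1).det⁻¹) (𝓝 z) (𝓝 (L * z.1).det⁻¹) :=
      (hg.matrix_det.tendsto z).inv₀ (by rw [hL, Matrix.det_one]; exact one_ne_zero)
    rw [hL, Matrix.det_one, inv_one] at h1
    simpa only [Ring.inverse_eq_inv'] using h1
  have h2 := hdet.smul (hg.matrix_adjugate.tendsto z)
  simp only [hL, Matrix.adjugate_one, one_smul] at h2
  exact h2

theorem tendsto_sliceRep {z : Factors m n r} {L : Matrix (Fin r) (Fin m) ℝ} (hL : L * z.1 = 1) :
    Tendsto (sliceRep (n := n) L) (𝓝 z) (𝓝 z) := by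
  have hmul₁ : Continuous fun p : Matrix (Fin m) (Fin r) ℝ × Matrix (Fin r) (Fin r) ℝ =>
      p.1 * p.2 := continuous_fst.matrix_mul continuous_snd
  have h1 : Tendsto (fun x : Factors m n r => x.1 * (L * x.1)⁻¹) (𝓝 z) (𝓝 z.1) := by
    have := (hmul₁.tendsto (z.1, 1)).comp
      ((continuous_fst.tendsto z).prodMk_nhds (tendsto_inv_mul hL))
    simpa [Function.comp_def] using this
  have h2 : Tendsto (fun x : Factors m n r => L * x.1 * x.2) (𝓝 z) (𝓝 z.2) := by
    have hc : Continuous fun x : Factors m n r => L * x.1 * x.2 :=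
      (continuous_const.matrix_mul continuous_fst).matrix_mul continuous_snd
    have := hc.tendsto z
    rwa [hL, Matrix.one_mul] at this
  exact h1.prodMk_nhds h2

theorem eventually_isUnit_mul {z : Factors m n r} {L : Matrix (Fin r) (Fin m) ℝ}
    (hL : L * z.1 = 1) : ∀ᶠ x : Factors m n r in 𝓝 z, IsUnit (L * x.1).det := by
  have hg : Continuous fun x : Factors m n r => (L * x.1).det :=
    (continuous_const.matrix_mul continuous_fst).matrix_det
  have : ∀ᶠ x : Factors m n r in 𝓝 z, (L * x.1).det ≠ 0 :=
    hg.continuousAt.eventually_ne (by rw [hL, Matrix.det_one]; exact one_ne_zero)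
  exact this.mono fun x hx => hx.isUnit

theorem sq_gradNorm (Y : Matrix (Fin m) (Fin n) ℝ) (x : Factors m n r) :
    gradNorm Y x ^ 2 = ‖gradA Y x‖ ^ 2 + ‖gradB Y x‖ ^ 2 :=
  Real.sq_sqrt (by positivity)

theorem norm_grad_le_gradNorm (Y : Matrix (Fin m) (Fin n) ℝ) (x : Factors m n r) :
    ‖(gradA Y x, gradB Y x)‖ ≤ gradNorm Y x := by
  refine max_le ?_ ?_ <;> refine Real.le_sqrt_of_sq_le ?_ <;> simp only <;>
    nlinarith [sq_nonneg ‖gradA Y x‖, sq_nonneg ‖gradB Y x‖]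

section
variable {L : Matrix (Fin r) (Fin m) ℝ} {x : Factors m n r}

theorem mul_sliceRep_fst (hx : IsUnit (L * x.1).det) : L * (sliceRep L x).1 = 1 := by
  rw [sliceRep, ← Matrix.mul_assoc, Matrix.mul_nonsing_inv _ hx]

theorem sliceRep_mul (hx : IsUnit (L * x.1).det) :
    (sliceRep L x).1 * (sliceRep L x).2 = x.1 * x.2 := by
  simp only [sliceRep]
  rw [Matrix.mul_assoc x.1, ← Matrix.mul_assoc (L * x.1)⁻¹, Matrix.nonsing_inv_mul _ hx,
    Matrix.one_mul]

theorem gradA_sliceRep (hx : IsUnit (L * x.1).det) :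
    gradA Y (sliceRep L x) = gradA Y x * (L * x.1)ᵀ := by
  rw [gradA, sliceRep_mul hx, gradA, sliceRep, Matrix.transpose_mul, Matrix.mul_assoc]

theorem gradB_sliceRep (hx : IsUnit (L * x.1).det) :
    gradB Y (sliceRep L x) = ((L * x.1)⁻¹)ᵀ * gradB Y x := by
  rw [gradB, sliceRep_mul hx, gradB, sliceRep, Matrix.transpose_mul, Matrix.mul_assoc]

theorem mem_orbit_sliceRep (hx : IsUnit (L * x.1).det) : x ∈ orbit (sliceRep L x) := by
  refine ⟨⟨L * x.1, (L * x.1)⁻¹, Matrix.mul_nonsing_inv _ hx, Matrix.nonsing_inv_mul _ hx⟩,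
    Prod.ext ?_ ?_⟩
  · change x.1 * (L * x.1)⁻¹ * (L * x.1) = x.1
    rw [Matrix.mul_assoc, Matrix.nonsing_inv_mul _ hx, Matrix.mul_one]
  · change (L * x.1)⁻¹ * (L * x.1 * x.2) = x.2
    rw [← Matrix.mul_assoc, Matrix.nonsing_inv_mul _ hx, Matrix.one_mul]

end

/-- Near a minimizer the critical points are minimizers: the representative in the slice of a
critical point is critical, hence equal to `z`. -/
theorem SpectralGap.eventually_mem_orbit_of_critical (h : SpectralGap Y V₁ V₂ d₁ d₂ μ)
    {z : Factors m n r} (hz : z ∈ minimizers r Y) :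
    ∀ᶠ x : Factors m n r in 𝓝 z, gradA Y x = 0 ∧ gradB Y x = 0 → x ∈ orbit z := by
  obtain ⟨L, -, hL, -⟩ := h.exists_inverses hz
  obtain ⟨c, -, hc⟩ := h.exists_norm_sub_le_on_slice hz hL
  filter_upwards [(tendsto_sliceRep hL).eventually hc, eventually_isUnit_mul hL]
    with x hx hu ⟨hA, hB⟩
  have h1 := hx (mul_sliceRep_fst hu)
  rw [gradA_sliceRep hu, gradB_sliceRep hu, hA, hB, Matrix.zero_mul, Matrix.mul_zero,
    Prod.mk_zero_zero, norm_zero, mul_zero] at h1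
  have h2 : sliceRep L x = z := sub_eq_zero.1 (norm_le_zero_iff.1 h1)
  have h3 := mem_orbit_sliceRep hu
  rwa [h2] at h3

/-- The Łojasiewicz inequality. On the slice the excess loss is `O(‖y - z‖²)` and the gradient is
bounded below by a multiple of `‖y - z‖`; moving to the slice keeps the loss and changes the
gradient by the factors `g` and `g⁻¹`, which are close to the identity. -/
theorem SpectralGap.exists_lojasiewicz (h : SpectralGap Y V₁ V₂ d₁ d₂ μ)
    {z : Factors m n r} (hz : z ∈ minimizers r Y) :
    ∃ C : ℝ, 0 < C ∧
      ∀ᶠ x : Factors m n r in 𝓝 z, √(loss Y x - loss Y z) ≤ C * gradNorm Y x := by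
  obtain ⟨L, -, hL, -⟩ := h.exists_inverses hz
  obtain ⟨c, hc0, hc⟩ := h.exists_norm_sub_le_on_slice hz hL
  obtain ⟨b, hb0, hb⟩ := exists_loss_sub_le hz
  set N : ℝ := ‖(1 : Matrix (Fin r) (Fin r) ℝ)‖ + 1 with hN
  have hN0 : 0 < N := by positivity
  have hg : ∀ᶠ x : Factors m n r in 𝓝 z, ‖L * x.1‖ < N := by
    have hcont : Continuous fun x : Factors m n r => L * x.1 :=
      continuous_const.matrix_mul continuous_fst
    have ht := hcont.tendsto z
    rw [hL] at ht
    exact ht.norm.eventually_lt_const (lt_add_one _)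
  have hg' : ∀ᶠ x : Factors m n r in 𝓝 z, ‖(L * x.1)⁻¹‖ < N :=
    (tendsto_inv_mul hL).norm.eventually_lt_const (lt_add_one _)
  refine ⟨√b * (c * N), by positivity, ?_⟩
  filter_upwards [(tendsto_sliceRep hL).eventually hc, (tendsto_sliceRep hL).eventually hb,
    eventually_isUnit_mul hL, hg, hg'] with x h1 h2 hu h3 h4
  have e : loss Y (sliceRep L x) = loss Y x := by rw [loss, loss, sliceRep_mul hu]
  rw [e] at h2
  have hgrad : ‖(gradA Y (sliceRep L x), gradB Y (sliceRep L x))‖ ≤ N * gradNorm Y x := by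
    have hG := norm_grad_le_gradNorm Y x
    have hA : ‖gradA Y x‖ ≤ gradNorm Y x := (le_max_left _ _).trans hG
    have hB : ‖gradB Y x‖ ≤ gradNorm Y x := (le_max_right _ _).trans hG
    rw [gradA_sliceRep hu, gradB_sliceRep hu]
    refine max_le ?_ ?_
    · refine (Matrix.frobenius_norm_mul _ _).trans ?_
      rw [Matrix.frobenius_norm_transpose, mul_comm]
      exact mul_le_mul h3.le hA (norm_nonneg _) hN0.le
    · refine (Matrix.frobenius_norm_mul _ _).trans ?_
      rw [Matrix.frobenius_norm_transpose]
      exact mul_le_mul h4.le hB (norm_nonneg _) hN0.le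
  calc √(loss Y x - loss Y z) ≤ √(b * ‖sliceRep L x - z‖ ^ 2) := Real.sqrt_le_sqrt h2
    _ = √b * ‖sliceRep L x - z‖ := by
        rw [Real.sqrt_mul hb0.le, Real.sqrt_sq (norm_nonneg _)]
    _ ≤ √b * (c * (N * gradNorm Y x)) := by
        refine mul_le_mul_of_nonneg_left ?_ (Real.sqrt_nonneg _)
        exact (h1 (mul_sliceRep_fst hu)).trans (mul_le_mul_of_nonneg_left hgrad hc0.le)
    _ = _ := by ring

end

/-! ### Exponential convergence of the flow -/

open scoped MatrixOrder in
/-- Close to a critical point the smoothed orthogonalization is an ascent direction with factor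
`(2β)^{-1/2}`: the spectrum of `M Mᵀ + β I` lies in `[β, 2β]` once `‖M‖² ≤ β`. -/
theorem norm_sq_le_trace_Tβ {p q : ℕ} {β : ℝ} (hβ : 0 < β) (M : Matrix (Fin p) (Fin q) ℝ)
    (hM : ‖M‖ ^ 2 ≤ β) : 1 / √(2 * β) * ‖M‖ ^ 2 ≤ (Tβ β M * Mᵀ).trace := by
  set H : Matrix (Fin p) (Fin p) ℝ := M * Mᵀ + β • 1 with hH
  have hMM : (M * Mᵀ).PosSemidef := by
    have := Matrix.posSemidef_self_mul_conjTranspose M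
    rwa [Matrix.conjTranspose_eq_transpose_of_trivial] at this
  have hHherm : H.IsHermitian := hMM.isHermitian.add (by
    rw [Matrix.IsHermitian, Matrix.conjTranspose_smul, Matrix.conjTranspose_one, star_trivial])
  have hge : algebraMap ℝ _ β ≤ H := by
    rw [Matrix.le_iff, hH, Algebra.algebraMap_eq_smul_one, add_sub_cancel_right]
    exact hMM
  have hlow : ∀ x ∈ spectrum ℝ H, β ≤ x :=
    (algebraMap_le_iff_le_spectrum (ha := hHherm)).1 hge
  have hup : ∀ x ∈ spectrum ℝ H, x ≤ 2 * β := by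
    intro x hx
    rw [hHherm.spectrum_real_eq_range_eigenvalues] at hx
    obtain ⟨i, rfl⟩ := hx
    have htr : ∑ j, (hHherm.eigenvalues j - β) = ‖M‖ ^ 2 := by
      have h1 : H.trace = ∑ j, hHherm.eigenvalues j := hHherm.trace_eq_sum_eigenvalues
      have h2 : H.trace = ‖M‖ ^ 2 + p * β := by
        rw [hH, Matrix.trace_add, ← norm_sq_eq_trace, Matrix.trace_smul, Matrix.trace_one,
          Fintype.card_fin, smul_eq_mul, mul_comm β]
      rw [Finset.sum_sub_distrib, ← h1, h2, Finset.sum_const, Finset.card_univ, Fintype.card_fin,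
        nsmul_eq_mul, add_sub_cancel_right]
    have hle := Finset.single_le_sum (f := fun j => hHherm.eigenvalues j - β)
      (fun j _ => sub_nonneg.2 (hlow _ (hHherm.eigenvalues_mem_spectrum_real j)))
      (Finset.mem_univ i)
    linarith
  set F := cfc (fun s : ℝ => s ^ (-(1 / 2) : ℝ)) H with hF
  have hFge : algebraMap ℝ _ (1 / √(2 * β)) ≤ F := by
    refine algebraMap_le_cfc _ _ _ (fun x hx => ?_) (Matrix.finite_real_spectrum.continuousOn _)
      hHherm
    have e : 1 / √(2 * β) = (2 * β) ^ (-(1 / 2) : ℝ) := by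
      rw [Real.rpow_neg (by positivity), ← Real.sqrt_eq_rpow, one_div]
    rw [e]
    exact Real.rpow_le_rpow_of_nonpos (hβ.trans_le (hlow x hx)) (hup x hx) (by norm_num)
  rw [Matrix.le_iff] at hFge
  have h1 := (hFge.conjTranspose_mul_mul_same M).trace_nonneg
  rw [Matrix.conjTranspose_eq_transpose_of_trivial, Matrix.mul_sub, Matrix.sub_mul,
    Matrix.trace_sub, Algebra.algebraMap_eq_smul_one, Matrix.mul_smul, Matrix.mul_one,
    Matrix.smul_mul, Matrix.trace_smul, ← norm_sq_eq_trace_transpose_mul, Matrix.mul_assoc,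
    Matrix.trace_mul_comm, smul_eq_mul] at h1
  change _ ≤ (F * M * Mᵀ).trace
  linarith

/-- Along the flow the loss decreases at rate at least `(2β)^{-1/2} ‖∇L‖²` once the gradient is
small, and the Łojasiewicz inequality turns this into exponential decay. -/
theorem exists_exponential_decay {m n r : ℕ} {Y : Matrix (Fin m) (Fin n) ℝ} {z : Factors m n r}
    (hz : z ∈ minimizers r Y) {C : ℝ} (hC : 0 < C)
    (hloj : ∀ᶠ x in 𝓝 z, √(loss Y x - loss Y z) ≤ C * gradNorm Y x) {β : ℝ} (hβ : 0 < β)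
    {x : ℝ → Factors m n r} (hx : IsSpecGF Y β x) (hlim : Tendsto x atTop (𝓝 z)) :
    ∃ T : ℝ, 0 ≤ T ∧ ∀ t : ℝ, T ≤ t →
      loss Y (x t) - loss Y z ≤ (loss Y (x T) - loss Y z) *
        Real.exp (-(1 / (C ^ 2 * √(2 * β))) * (t - T)) := by
  have hsmall : ∀ᶠ y : Factors m n r in 𝓝 z, ‖gradA Y y‖ ^ 2 < β ∧ ‖gradB Y y‖ ^ 2 < β := by
    obtain ⟨D, -, hD⟩ := exists_hasFDerivAt_grad Y z
    obtain ⟨hA, hB⟩ := grad_eq_zero_of_mem_minimizers hz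
    have hcont := hD.continuousAt
    have h1 := (hcont.fst.norm.pow 2).tendsto.eventually_lt_const (u := β) (by simpa [hA] using hβ)
    have h2 := (hcont.snd.norm.pow 2).tendsto.eventually_lt_const (u := β) (by simpa [hB] using hβ)
    exact h1.and h2
  obtain ⟨T, hT⟩ := eventually_atTop.1
    (((hlim.eventually hloj).and (hlim.eventually hsmall)).and (eventually_gt_atTop (0 : ℝ)))
  have hT0 : 0 < T := (hT T le_rfl).2
  refine ⟨T, hT0.le, fun t ht => ?_⟩
  set k : ℝ := 1 / (C ^ 2 * √(2 * β)) with hk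
  have hderiv : ∀ t, T ≤ t → HasDerivAt (fun t => loss Y (x t))
      (pairing (gradA Y (x t), gradB Y (x t))
        (-Tβ β (gradA Y (x t)), -Tβ β (gradB Y (x t)))) t := fun t ht =>
    (hasFDerivAt_loss Y (x t)).comp_hasDerivAt t
      ((hx t (hT0.le.trans ht)).hasDerivAt (Ici_mem_nhds (hT0.trans_le ht)))
  have hbound : ∀ t, T ≤ t → pairing (gradA Y (x t), gradB Y (x t))
      (-Tβ β (gradA Y (x t)), -Tβ β (gradB Y (x t))) ≤ -(k * (loss Y (x t) - loss Y z)) := by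
    intro t ht
    obtain ⟨⟨h1, h2, h3⟩, -⟩ := hT t ht
    have hA := norm_sq_le_trace_Tβ hβ _ h2.le
    have hB := norm_sq_le_trace_Tβ hβ _ h3.le
    have h0 : 0 ≤ loss Y (x t) - loss Y z := sub_nonneg.2 (hz _)
    have h4 : loss Y (x t) - loss Y z ≤ C ^ 2 * gradNorm Y (x t) ^ 2 := by
      rw [← mul_pow, ← Real.sq_sqrt h0]
      exact pow_le_pow_left₀ (Real.sqrt_nonneg _) h1 2
    have h5 : k * (loss Y (x t) - loss Y z) ≤ 1 / √(2 * β) * gradNorm Y (x t) ^ 2 := by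
      have hk0 : 0 ≤ k := by positivity
      refine (mul_le_mul_of_nonneg_left h4 hk0).trans_eq ?_
      rw [hk]
      have : √(2 * β) ≠ 0 := (Real.sqrt_pos.2 (by positivity)).ne'
      field_simp
    rw [sq_gradNorm] at h5
    rw [pairing_apply, Matrix.neg_mul, Matrix.neg_mul, Matrix.trace_neg, Matrix.trace_neg]
    linarith
  have hexp : ∀ t : ℝ, HasDerivAt (fun t : ℝ => Real.exp (k * t)) (Real.exp (k * t) * k) t :=
    fun t => by simpa using ((hasDerivAt_id t).const_mul k).exp
  have hanti : AntitoneOn (fun t => (loss Y (x t) - loss Y z) * Real.exp (k * t)) (Set.Ici T) := by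
    refine antitoneOn_of_deriv_nonpos (convex_Ici T) ?_ ?_ ?_
    · exact fun t ht =>
        (((hderiv t ht).sub_const _).mul (hexp t)).continuousAt.continuousWithinAt
    · intro t ht
      rw [interior_Ici] at ht
      exact (((hderiv t ht.le).sub_const _).mul
        (hexp t)).differentiableAt.differentiableWithinAt
    · intro t ht
      rw [interior_Ici] at ht
      have hd : HasDerivAt (fun t => (loss Y (x t) - loss Y z) * Real.exp (k * t)) _ t :=
        ((hderiv t (le_of_lt ht)).sub_const _).mul (hexp t)
      rw [hd.deriv]
      nlinarith [hbound t (le_of_lt ht), Real.exp_pos (k * t)]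
  have hfin := hanti (Set.self_mem_Ici) (Set.mem_Ici.2 ht) ht
  simp only at hfin
  calc loss Y (x t) - loss Y z
      = (loss Y (x t) - loss Y z) * Real.exp (k * t) * Real.exp (-(k * t)) := by
        rw [mul_assoc, ← Real.exp_add, add_neg_cancel, Real.exp_zero, mul_one]
    _ ≤ (loss Y (x T) - loss Y z) * Real.exp (k * T) * Real.exp (-(k * t)) :=
        mul_le_mul_of_nonneg_right hfin (Real.exp_pos _).le
    _ = _ := by rw [mul_assoc, ← Real.exp_add]; congr 2; ring

end SpecGF

theorem proposition6p6 (m n r : ℕ) (Y : Matrix (Fin m) (Fin n) ℝ) (hr : r ≤ Y.rank)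
    (hY : SpecGF.DistinctSingularValues Y)
    (z : SpecGF.Factors m n r) (hz : z ∈ SpecGF.minimizers r Y) :
    -- the excess loss is Morse-Bott at `z` along the `GL(r)`-orbit of minimizers
    (z.1.rank = r ∧ z.2.rank = r ∧
      SpecGF.minimizers r Y = SpecGF.orbit z ∧
      (∀ᶠ x in 𝓝 z, SpecGF.gradA Y x = 0 ∧ SpecGF.gradB Y x = 0 → x ∈ SpecGF.orbit z) ∧
      SpecGF.hessianKer Y z = SpecGF.tangentVectors (SpecGF.orbit z) z) ∧
    ∃ C : ℝ, 0 < C ∧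
      -- Lojasiewicz inequality with exponent `1/2` near `z`
      (∀ᶠ x in 𝓝 z, √(SpecGF.loss Y x - SpecGF.loss Y z) ≤ C * SpecGF.gradNorm Y x) ∧
      -- exponential convergence of the loss along every trajectory converging to `z`
      ∀ β : ℝ, 0 < β → ∀ x : ℝ → SpecGF.Factors m n r,
        SpecGF.IsSpecGF Y β x → Tendsto x atTop (𝓝 z) →
        ∃ T : ℝ, 0 ≤ T ∧ ∀ t : ℝ, T ≤ t →
          SpecGF.loss Y (x t) - SpecGF.loss Y z ≤
            (SpecGF.loss Y (x T) - SpecGF.loss Y z) *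
              Real.exp (-(1 / (C ^ 2 * √(2 * β))) * (t - T)) := by
  obtain ⟨s, V₁, V₂, d₁, d₂, μ, h⟩ := SpecGF.exists_spectralGap Y hr hY
  obtain ⟨L, K, hL, hK⟩ := h.exists_inverses hz
  refine ⟨⟨?_, ?_, h.minimizers_eq_orbit hz, h.eventually_mem_orbit_of_critical hz,
    SpecGF.hessianKer_eq_tangentVectors h hz⟩, ?_⟩
  · refine le_antisymm (by simpa using z.1.rank_le_width) ?_
    simpa [hL] using Matrix.rank_mul_le_right L z.1
  · refine le_antisymm (by simpa using z.2.rank_le_height) ?_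
    simpa [hK] using Matrix.rank_mul_le_left z.2 (V₁ * K)
  · obtain ⟨C, hC, hloj⟩ := h.exists_lojasiewicz hz
    exact ⟨C, hC, hloj, fun β hβ x hx hlim =>
      SpecGF.exists_exponential_decay hz hC hloj hβ hx hlim⟩
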